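/- Let $n\ge 3$ and $d\ge 3$ be integers, let $S=\mathbb{C}[x_1,\dots,x_n]$ with the standard grading, and put $T=n(d-2)$. For $f\in S_d$ let $J(f)=(\partial f/\partial x_1,\dots,\partial f/\partial x_n)$ be its Jacobian ideal and $M(f)=S/J(f)$ its Milnor algebra. If the hypersurface $f=0$ in $\mathbb{P}^{n-1}$ is smooth, then $M(f)$ is a graded Artinian Gorenstein algebra with socle degree $T$; let $\omega:\mathrm{Soc}(M(f))\to\mathbb{C}$ be the linear isomorphism that sends the class of the Hessian determinant of $f$ to $1$, and let $A_f\in\mathbb{C}[y_1,\dots,y_n]_T$ be the associated form $$A_f(y_1,\dots,y_n)=\omega\big((y_1\overline{x_1}+\dots+y_n\overline{x_n})^T\big),$$ where $\overline{x_i}$ is the class of $x_i$ in $M(f)$. Let $\mathcal{V}^{T-1}_n=\{[\ell^{T-1}] : 0\ne\ell\in S_1\}\subseteq\mathbb{P}(S_{T-1})$ be the Veronese variety. We say that the SLP holds in degree $1$ for $M(f)$ if for a generic linear form $\ell\in S_1$ the multiplication map $$\ell^{T-2}:M(f)_1\to M(f)_{T-1}$$ is an isomorphism. (Generic means: for all elements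 of some nonempty Zariski open subset.) (a) Let $f\in S_d$ be such that the hypersurface $f=0$ in $\mathbb{P}^{n-1}$ is smooth, and suppose that $f$ satisfies one of the following (equivalent) conditions: (1) the projective hypersurface $A_f(y_1,\dots,y_n)=0$ is smooth; (2) $\mathbb{P}(J(f)_{T-1})\cap\mathcal{V}^{T-1}_n=\emptyset$ in $\mathbb{P}(S_{T-1})$. Then the SLP holds in degree $1$ for $M(f)$. (b) In particular, for a generic polynomial $f\in S_d$ the hypersurface $f=0$ is smooth and the SLP holds in degree $1$ for $M(f)$. -/

import Mathlib

noncomputable section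

namespace CompleteIntersection

open MvPolynomial LinearAlgebra.Projectivization

/-- The polynomial ring `S = ℂ[x_1, …, x_n]` (also used for the ring `R` in the dual variables). -/
abbrev Poly (n : ℕ) := MvPolynomial (Fin n) ℂ

/-- The graded piece `S_m`: the forms of degree `m`, together with zero. -/
abbrev Forms (n m : ℕ) : Submodule ℂ (Poly n) := homogeneousSubmodule (Fin n) ℂ m

/-- A property holds for a generic form of degree `m` if it holds on a nonempty Zariski open subset
of the affine space `S_m`. As the principal open sets `P ≠ 0`, with `P` a polynomial in the
coefficients of the form, are a basis of the Zariski topology, one nonempty such set is required. -/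
def ForGenericForm (n m : ℕ) (p : Poly n → Prop) : Prop :=
  ∃ P : MvPolynomial (Fin n →₀ ℕ) ℂ,
    (∃ g ∈ Forms n m, eval (fun α => coeff α g) P ≠ 0) ∧
    ∀ g ∈ Forms n m, eval (fun α => coeff α g) P ≠ 0 → p g

/-- The projective hypersurface `F = 0` in `ℙ^{n-1}` is smooth: no point of `ℙ^{n-1}` is a common
zero of the form `F` and of all its first partial derivatives. -/
def IsSmoothHypersurface {n : ℕ} (F : Poly n) : Prop :=
  ∀ p : Fin n → ℂ, p ≠ 0 → eval p F = 0 → ∃ i, eval p (pderiv i F) ≠ 0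

/-- The partial derivatives of `f`. -/
def gradient {n : ℕ} (f : Poly n) : Fin n → Poly n := fun i => pderiv i f

/-- The ideal `J(φ) = (φ_1, …, φ_n)`. For `φ = gradient f` this is the Jacobian ideal `J(f)`. -/
def J {n : ℕ} (φ : Fin n → Poly n) : Ideal (Poly n) := Ideal.span (Set.range φ)

/-- The algebra `M(φ) = S / J(φ)`. For `φ = gradient f` this is the Milnor algebra `M(f)`. -/
abbrev M {n : ℕ} (φ : Fin n → Poly n) := Poly n ⧸ J φ

/-- The class in `M(φ)` of a polynomial. -/
abbrev toM {n : ℕ} (φ : Fin n → Poly n) : Poly n →ₐ[ℂ] M φ := Ideal.Quotient.mkₐ ℂ (J φ)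

/-- The graded piece `M(φ)_k`, the image of `S_k`. -/
def gradedPiece {n : ℕ} (φ : Fin n → Poly n) (k : ℕ) : Submodule ℂ (M φ) :=
  (Forms n k).map (toM φ).toLinearMap

/-- The strong Lefschetz property in degree `k` of the algebra `M(φ)` with socle degree `T`: for a
generic linear form `ℓ`, multiplication by `ℓ^(T-2k)` is a bijection from `M(φ)_k` to `M(φ)_{T-k}`
(hence an isomorphism, since multiplication is linear). It is meant for `2 * k ≤ T`. -/
def SLPInDegree {n : ℕ} (φ : Fin n → Poly n) (T k : ℕ) : Prop :=
  ForGenericForm n 1 fun ℓ =>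
    Set.BijOn (fun z : M φ => toM φ ℓ ^ (T - 2 * k) * z)
      (gradedPiece φ k) (gradedPiece φ (T - k))

/-- The socle of `M(φ)`: the elements annihilated by the maximal ideal `(x_1, …, x_n)`. -/
def socle {n : ℕ} (φ : Fin n → Poly n) : Submodule ℂ (M φ) where
  carrier := {z | ∀ i, toM φ (X i) * z = 0}
  add_mem' := fun {a b} ha hb i => by rw [mul_add, ha i, hb i, add_zero]
  zero_mem' := fun i => mul_zero _
  smul_mem' := fun c z hz i => by rw [mul_smul_comm, hz i, smul_zero]

/-- The determinant of the Jacobian matrix of `φ : ℂ^n → ℂ^n`.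
For `φ = gradient f` it is the Hessian determinant of `f`. -/
def jac {n : ℕ} (φ : Fin n → Poly n) : Poly n :=
  (Matrix.of fun i j => pderiv j (φ i)).det

/-- `A` is the associated form of `φ`, where `T` is the socle degree of `M(φ)`: for the linear
isomorphism `ω : Soc M(φ) → ℂ` that takes the class of `jac φ` to `1`, one has
`A(y_1, …, y_n) = ω((y_1 x_1 + ⋯ + y_n x_n)^T)` for all `y ∈ ℂ^n`. -/
def IsAssociatedForm {n : ℕ} (φ : Fin n → Poly n) (T : ℕ) (A : Poly n) : Prop :=
  ∃ ω : socle φ ≃ₗ[ℂ] ℂ,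
    (∃ h : toM φ (jac φ) ∈ socle φ, ω ⟨toM φ (jac φ), h⟩ = 1) ∧
    ∀ y : Fin n → ℂ, ∃ h : (∑ i, y i • toM φ (X i)) ^ T ∈ socle φ,
      eval y A = ω ⟨(∑ i, y i • toM φ (X i)) ^ T, h⟩

/-- There is at most one associated form. -/
theorem IsAssociatedForm.unique {n : ℕ} {φ : Fin n → Poly n} {T : ℕ} {A B : Poly n}
    (hA : IsAssociatedForm φ T A) (hB : IsAssociatedForm φ T B) : A = B := by
  obtain ⟨ω, ⟨h, h1⟩, hω⟩ := hA
  obtain ⟨η, ⟨h', h1'⟩, hη⟩ := hB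
  have key : ∀ z, ω z = η z := by
    intro z
    have hz : z = ω z • ⟨toM φ (jac φ), h⟩ := by
      apply ω.injective
      rw [map_smul, h1, smul_eq_mul, mul_one]
    conv_rhs => rw [hz]
    rw [map_smul, h1', smul_eq_mul, mul_one]
  apply MvPolynomial.funext
  intro y
  obtain ⟨k, hk⟩ := hω y
  obtain ⟨k', hk'⟩ := hη y
  rw [hk, hk', key]

open Classical in
/-- The associated form `A_φ` of `φ`. It exists whenever `J(φ)` is a zero-dimensional homogeneous
complete intersection with socle degree `T`; the value `0` elsewhere is a convention. -/
def associatedForm {n : ℕ} (φ : Fin n → Poly n) (T : ℕ) : Poly n :=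
  if h : ∃ A, IsAssociatedForm φ T A then h.choose else 0

/-- The `m`-th power of a nonzero linear form, as a point of `ℙ(S_m)`. -/
def veronesePoint {n : ℕ} (m : ℕ) (ℓ : {ℓ : Forms n 1 // ℓ ≠ 0}) : ℙ ℂ (Forms n m) :=
  Projectivization.mk ℂ
    ⟨(ℓ.1 : Poly n) ^ m, by
      have h := ((mem_homogeneousSubmodule 1 _).1 ℓ.1.2).pow m
      rw [one_mul] at h
      exact (mem_homogeneousSubmodule m _).2 h⟩
    (fun h => pow_ne_zero m (fun h0 => ℓ.2 (Subtype.ext h0)) (congrArg Subtype.val h))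

/-- The Veronese variety `𝒱^m_n ⊆ ℙ(S_m)`, the image of `ℙ(S_1)` under `ℓ ↦ ℓ^m`. -/
def veroneseVariety (n m : ℕ) : Set (ℙ ℂ (Forms n m)) := Set.range (veronesePoint m)

/-- The linear subspace `ℙ(I_m) ⊆ ℙ(S_m)` given by the forms of degree `m` in the ideal `I`. -/
def projIdealPiece {n : ℕ} (I : Ideal (Poly n)) (m : ℕ) : Set (ℙ ℂ (Forms n m)) :=
  {q | ∀ g ∈ q.submodule, (g : Poly n) ∈ I}

end CompleteIntersection

end

/-!
The argument rests on one elementary fact, `det_notMem_J`: if `φ = E x` for a square matrix `E` and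
the ideal `J(φ)` contains powers of all the variables, then `det E ∉ J(φ)`. For forms `φ_i` of one
degree without a common zero, Euler's identity turns it into `jac φ ∉ J(φ)`; in particular the
Jacobian determinant is not zero. Neither regular sequences nor Hilbert series are needed.

*Duality.* The Bezoutian in `M(φ) ⊗ M(φ)` shows that the socle of `M(φ)` is at most a line
(`exists_socle_generator`), so it is spanned by the class of `jac φ`, which has degree
`T = n (e - 1)` if the `φ_i` have degree `e`. Hence a functional `τ` on `M(φ)` that does not vanish
on `jac φ` gives perfect pairings between `M(φ)_j` and `M(φ)_{T-j}` (`mem_J_of_pairing_eq_zero`).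

*From a condition on powers to the SLP.* If `ℓ^(T-1) ∉ J(f)` for all nonzero linear forms `ℓ`, the
`n` forms `y ↦ τ(x_i ℓ_y^(T-1))` have no common zero, so their Jacobian determinant is not zero.
At a point `y` where it does not vanish, the matrix `τ(x_i x_j ℓ_y^(T-2))` is invertible and
multiplication by `ℓ_y^(T-2)` is onto `M(f)_{T-1}` (`exists_powMulSurjective`). Surjectivity is an
open condition on `ℓ` and forces injectivity by duality (`slpInDegree_one_of_powMulSurjective`).
Smoothness of the associated form implies the condition on powers, because its partial derivatives
at `y` are the numbers `T ω(x_i ℓ_y^(T-1))`.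

*Generic forms.* Smoothness of `f` and surjectivity of `ℓ^(T-2)` for a fixed `ℓ` say that families of
forms depending polynomially on `f` span all forms of a given degree, so they are open conditions
(`exists_eval_ne_zero_imp_forms_le_span`). Both hold for the Fermat form and
`ℓ = x_1 + ⋯ + x_n` (`powMulSurjective_fermat`), although `x_1^(T-1) ∈ J(f)` there.
-/

noncomputable section

namespace CompleteIntersection

open MvPolynomial
open scoped TensorProduct

/-! ### Determinants modulo powers of the variables -/

/-- The variable `x_j` is a nonzerodivisor modulo powers of the other variables. -/
theorem mem_span_X_pow_of_X_mul_mem {n N : ℕ} (j : Fin n) (s : Set (Fin n)) (hj : j ∉ s)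
    {g : Poly n} (h : X j * g ∈ Ideal.span ((fun i => (X i : Poly n) ^ N) '' s)) :
    g ∈ Ideal.span ((fun i => (X i : Poly n) ^ N) '' s) := by
  have key : (fun i => (X i : Poly n) ^ N) '' s =
      (fun α => monomial α (1 : ℂ)) '' ((fun i => Finsupp.single i N) '' s) := by
    rw [Set.image_image]
    simp only [X_pow_eq_monomial]
  rw [key, mem_ideal_span_monomial_image] at h ⊢
  intro α hα
  obtain ⟨_, ⟨i, hi, rfl⟩, hle⟩ := h (Finsupp.single j 1 + α) (by
    rw [mem_support_iff, coeff_X_mul]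
    exact mem_support_iff.1 hα)
  refine ⟨_, ⟨i, hi, rfl⟩, ?_⟩
  rw [Finsupp.single_le_iff] at hle ⊢
  have hij : j ≠ i := fun e => hj (e ▸ hi)
  simpa [Finsupp.single_apply, hij] using hle

theorem prod_X_pow_notMem_span_X_pow_succ {n : ℕ} (N : ℕ) :
    ∏ i, (X i : Poly n) ^ N ∉ Ideal.span (Set.range fun i => (X i : Poly n) ^ (N + 1)) := by
  have key : (Set.range fun i => (X i : Poly n) ^ (N + 1)) =
      (fun α => monomial α (1 : ℂ)) '' (Set.range fun i => Finsupp.single i (N + 1)) := by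
    rw [← Set.range_comp]
    simp only [X_pow_eq_monomial, Function.comp_def]
  have hp : ∏ i, (X i : Poly n) ^ N =
      monomial (Finsupp.equivFunOnFinite.symm fun _ => N) (1 : ℂ) := by
    rw [monomial_eq, C_1, one_mul, Finsupp.prod_fintype _ _ (by simp)]
    simp
  rw [key, mem_ideal_span_monomial_image, hp]
  intro h
  obtain ⟨_, ⟨i, rfl⟩, hle⟩ := h _ (by
    rw [mem_support_iff, coeff_monomial, if_pos rfl]
    exact one_ne_zero)
  rw [Finsupp.single_le_iff] at hle
  simp at hle

/-- Cramer's rule: the determinant of `E` times any coordinate of `v` lies in the ideal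
generated by the coordinates of `E v`. -/
theorem det_mul_mem_of_mulVec_mem {R ι : Type*} [CommRing R] [Fintype ι] [DecidableEq ι]
    (E : Matrix ι ι R) (v : ι → R) (I : Ideal R) (h : ∀ i, ∑ k, E i k * v k ∈ I) (k : ι) :
    v k * E.det ∈ I := by
  have h1 : E.adjugate.mulVec (E.mulVec v) = E.det • v := by
    rw [Matrix.mulVec_mulVec, Matrix.adjugate_mul, Matrix.smul_mulVec, Matrix.one_mulVec]
  have h2 := congrFun h1 k
  rw [Pi.smul_apply, smul_eq_mul, mul_comm] at h2
  rw [← h2]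
  exact Ideal.sum_mem _ fun i _ => Ideal.mul_mem_left _ _ (h i)

/-- If a matrix `E` takes `(x_1, …, x_n)` to `(x_1^(N+1), …, x_n^(N+1))`, as the diagonal matrix
with entries `x_i^N` does, then both determinants agree modulo the powers `x_i^(N+1)`.
The rows are exchanged one at a time; the difference is the determinant of a matrix one of whose
rows is a syzygy of the variables, and Cramer's rule applies to it. -/
theorem det_sub_prod_mem {n N : ℕ} (E : Matrix (Fin n) (Fin n) (Poly n))
    (hE : ∀ i, ∑ k, E i k * X k = X i ^ (N + 1)) :
    E.det - ∏ i, (X i : Poly n) ^ N ∈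
      Ideal.span (Set.range fun i => (X i : Poly n) ^ (N + 1)) := by
  classical
  set I := Ideal.span (Set.range fun i => (X i : Poly n) ^ (N + 1)) with hI
  set D : Matrix (Fin n) (Fin n) (Poly n) := Matrix.diagonal fun i => X i ^ N with hD
  have hDx : ∀ i, ∑ k, D i k * X k = X i ^ (N + 1) := by
    intro i
    rw [Finset.sum_eq_single i]
    · rw [hD, Matrix.diagonal_apply_eq, pow_succ]
    · intro k _ hk
      rw [hD, Matrix.diagonal_apply_ne _ hk.symm, zero_mul]
    · simp
  have main : ∀ s : Finset (Fin n),
      (Matrix.of fun i => if i ∈ s then E i else D i).det - D.det ∈ I := by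
    intro s
    induction s using Finset.induction_on with
    | empty =>
      simp only [Finset.notMem_empty, if_false]
      rw [show Matrix.of (fun i => D i) = D from rfl, sub_self]
      exact I.zero_mem
    | insert j s hj ih =>
      set B : Matrix (Fin n) (Fin n) (Poly n) := Matrix.of fun i => if i ∈ s then E i else D i
        with hB
      have hB' : (Matrix.of fun i => if i ∈ insert j s then E i else D i) =
          B.updateRow j (D j + (E j - D j)) := by
        ext i k
        by_cases hij : i = j
        · subst hij
          simp
        · simp [hB, hij]
      have hBB : B.updateRow j (D j) = B := by
        have : B j = D j := by
          funext k
          simp [hB, hj]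
        rw [← this, Matrix.updateRow_eq_self]
      rw [hB', Matrix.det_updateRow_add, hBB, add_sub_right_comm]
      refine I.add_mem ih ?_
      have hle : Ideal.span ((fun i => (X i : Poly n) ^ (N + 1)) '' {j}ᶜ) ≤ I :=
        Ideal.span_mono (Set.image_subset_range _ _)
      refine hle (mem_span_X_pow_of_X_mul_mem j _ (by simp) ?_)
      refine det_mul_mem_of_mulVec_mem _ X _ (fun i => ?_) j
      by_cases hij : i = j
      · subst hij
        simp only [Matrix.updateRow_self, Pi.sub_apply, sub_mul, Finset.sum_sub_distrib, hE, hDx,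
          sub_self]
        exact Ideal.zero_mem _
      · have hrow : ∑ k, B i k * X k = X i ^ (N + 1) := by
          by_cases his : i ∈ s
          · simpa [hB, his] using hE i
          · simpa [hB, his] using hDx i
        simp only [Matrix.updateRow_ne hij]
        rw [hrow]
        exact Ideal.subset_span ⟨i, by simpa using hij, rfl⟩
  have h := main Finset.univ
  simp only [Finset.mem_univ, if_true] at h
  rwa [hD, Matrix.det_diagonal] at h

/-- If `φ = E x` and the ideal `J(φ)` contains powers of all the variables, then `det E ∉ J(φ)`.
Write `x^(N+1) = B φ`. By Cramer's rule `det B` multiplies `J(φ)` into `(x_i^(N+1))`, while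
`det B * det E = det (B E)` is congruent to `∏ x_i^N`, which is not in that ideal. -/
theorem det_notMem_J {n N : ℕ} {φ : Fin n → Poly n} (E : Matrix (Fin n) (Fin n) (Poly n))
    (hE : ∀ i, φ i = ∑ k, E i k * X k) (hN : ∀ j, X j ^ (N + 1) ∈ J φ) : E.det ∉ J φ := by
  intro hdet
  have hN' : ∀ j, ∃ b : Fin n → Poly n, ∑ i, b i * φ i = X j ^ (N + 1) := fun j =>
    Ideal.mem_span_range_iff_exists_fun.1 (hN j)
  choose b hb using hN'
  set B : Matrix (Fin n) (Fin n) (Poly n) := Matrix.of b with hB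
  set I := Ideal.span (Set.range fun i => (X i : Poly n) ^ (N + 1)) with hI
  have hBφ : ∀ k, φ k * B.det ∈ I :=
    det_mul_mem_of_mulVec_mem B φ I fun i => by
      rw [hB]
      simp only [Matrix.of_apply, hb]
      exact Ideal.subset_span ⟨i, rfl⟩
  have hBJ : E.det * B.det ∈ I := by
    have hle : J φ ≤ I.colon {B.det} := by
      rw [J, Ideal.span_le]
      rintro _ ⟨k, rfl⟩
      exact Submodule.mem_colon_singleton.2 (hBφ k)
    exact Submodule.mem_colon_singleton.1 (hle hdet)
  have h1 : (B * E).det - ∏ i, (X i : Poly n) ^ N ∈ I := by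
    refine det_sub_prod_mem (B * E) fun i => ?_
    rw [← hb i]
    simp only [Matrix.mul_apply, Finset.sum_mul, hE, Finset.mul_sum]
    rw [Finset.sum_comm]
    simp only [hB, Matrix.of_apply, mul_assoc]
  rw [Matrix.det_mul, mul_comm] at h1
  refine prod_X_pow_notMem_span_X_pow_succ (n := n) N ?_
  have h2 := I.sub_mem hBJ h1
  rwa [sub_sub_cancel] at h2

/-! ### The Bezoutian and the socle -/

/-- Differences `p(x) - p(z)` lie in the ideal of the diagonal generated by `x_k - z_k`. -/
theorem exists_tmul_one_sub_one_tmul {n : ℕ} (p : Poly n) :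
    ∃ c : Fin n → Poly n ⊗[ℂ] Poly n,
      p ⊗ₜ[ℂ] (1 : Poly n) - (1 : Poly n) ⊗ₜ[ℂ] p =
        ∑ k, c k * ((X k : Poly n) ⊗ₜ[ℂ] (1 : Poly n) - (1 : Poly n) ⊗ₜ[ℂ] (X k : Poly n)) := by
  set v : Fin n → Poly n ⊗[ℂ] Poly n := fun k =>
    (X k : Poly n) ⊗ₜ[ℂ] (1 : Poly n) - (1 : Poly n) ⊗ₜ[ℂ] (X k : Poly n) with hv
  have hmem : p ⊗ₜ[ℂ] (1 : Poly n) - (1 : Poly n) ⊗ₜ[ℂ] p ∈ Ideal.span (Set.range v) := by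
    have h : (Ideal.Quotient.mkₐ ℂ (Ideal.span (Set.range v))).comp
        (Algebra.TensorProduct.includeLeft (R := ℂ) (S := ℂ) (A := Poly n) (B := Poly n)) =
        (Ideal.Quotient.mkₐ ℂ (Ideal.span (Set.range v))).comp
        (Algebra.TensorProduct.includeRight (R := ℂ) (A := Poly n) (B := Poly n)) := by
      refine MvPolynomial.algHom_ext fun k => ?_
      simp only [AlgHom.comp_apply, Algebra.TensorProduct.includeLeft_apply,
        Algebra.TensorProduct.includeRight_apply, Ideal.Quotient.mkₐ_eq_mk]
      exact Ideal.Quotient.eq.2 (Ideal.subset_span ⟨k, rfl⟩)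
    have h2 := DFunLike.congr_fun h p
    simp only [AlgHom.comp_apply, Algebra.TensorProduct.includeLeft_apply,
      Algebra.TensorProduct.includeRight_apply, Ideal.Quotient.mkₐ_eq_mk] at h2
    exact Ideal.Quotient.eq.1 h2
  obtain ⟨c, hc⟩ := Ideal.mem_span_range_iff_exists_fun.1 hmem
  exact ⟨c, hc.symm⟩

theorem toM_eq_zero_iff {n : ℕ} {φ : Fin n → Poly n} {p : Poly n} : toM φ p = 0 ↔ p ∈ J φ :=
  Ideal.Quotient.eq_zero_iff_mem

/-- An element of an algebra annihilated by all the variables is multiplied by a polynomial `p` as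
by the scalar `p(0)`. -/
theorem map_mul_of_socle {n : ℕ} {A : Type*} [CommRing A] [Algebra ℂ A] (q : Poly n →ₐ[ℂ] A)
    {u : Poly n} (hu : ∀ j, q (X j * u) = 0) (p : Poly n) :
    q u * q p = constantCoeff p • q u := by
  induction p using MvPolynomial.induction_on with
  | C a => rw [← algebraMap_eq, AlgHom.commutes, mul_comm, ← Algebra.smul_def]; simp
  | add p q hp hq => rw [map_add, mul_add, hp, hq, map_add, add_smul]
  | mul_X p i _ =>
    rw [← map_mul, show u * (p * X i) = p * (X i * u) by ring, map_mul, hu, mul_zero, map_mul,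
      constantCoeff_X, mul_zero, zero_smul]

/-- The socle of `M(φ)` is at most a line if `J(φ)` contains powers of all the variables; here
`M(φ)` is any algebra `A` with a map `q` from the polynomial ring whose kernel is `J(φ)`.
Let `D` be the Bezoutian of `φ`, the determinant of a matrix that takes `x - z` to `φ(x) - φ(z)`.
In `M(φ) ⊗ M(φ)` it does not distinguish `p ⊗ 1` from `1 ⊗ p`, by Cramer's rule. For `u` in
the socle this reads `u ⊗ D(0, z) = D(x, 0) ⊗ u`, and `D(x, 0)` is not zero in `M(φ)`. -/
theorem exists_socle_generator {n N : ℕ} {φ : Fin n → Poly n} {A : Type*} [CommRing A]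
    [Algebra ℂ A] (q : Poly n →ₐ[ℂ] A) (hq : ∀ p, q p = 0 ↔ p ∈ J φ)
    (h0 : ∀ i, constantCoeff (φ i) = 0) (hN : ∀ j, X j ^ (N + 1) ∈ J φ) :
    ∃ δ : Poly n, ∀ u : Poly n, (∀ j, X j * u ∈ J φ) → ∃ c : ℂ, q u = c • q δ := by
  choose c hc using fun i => exists_tmul_one_sub_one_tmul (φ i)
  set E : Matrix (Fin n) (Fin n) (Poly n ⊗[ℂ] Poly n) := Matrix.of c with hE
  set ε : Poly n →ₐ[ℂ] ℂ := aeval 0 with hε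
  have hεc : ∀ p, ε p = constantCoeff p := fun p => by
    rw [hε, aeval_zero]
    rfl
  set ρl : Poly n ⊗[ℂ] Poly n →ₐ[ℂ] Poly n :=
    Algebra.TensorProduct.lift ((Algebra.ofId ℂ (Poly n)).comp ε) (AlgHom.id ℂ _)
      (fun _ _ => Commute.all _ _) with hρl
  set ρr : Poly n ⊗[ℂ] Poly n →ₐ[ℂ] Poly n :=
    Algebra.TensorProduct.lift (AlgHom.id ℂ _) ((Algebra.ofId ℂ (Poly n)).comp ε)
      (fun _ _ => Commute.all _ _) with hρr
  set π : Poly n ⊗[ℂ] Poly n →ₐ[ℂ] A ⊗[ℂ] A :=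
    Algebra.TensorProduct.map (q) (q) with hπ
  have hρl' : ∀ p q, ρl (p ⊗ₜ q) = constantCoeff p • q := by
    intro p q
    rw [hρl, Algebra.TensorProduct.lift_tmul, AlgHom.comp_apply, hεc, Algebra.smul_def]
    rfl
  have hρr' : ∀ p q, ρr (p ⊗ₜ q) = constantCoeff q • p := by
    intro p q
    rw [hρr, Algebra.TensorProduct.lift_tmul, AlgHom.comp_apply, hεc, Algebra.smul_def, mul_comm]
    rfl
  have hXD : ∀ k, π ((X k : Poly n) ⊗ₜ 1) * π E.det = π (1 ⊗ₜ (X k : Poly n)) * π E.det := by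
    intro k
    have h := det_mul_mem_of_mulVec_mem E
      (fun k => (X k : Poly n) ⊗ₜ[ℂ] (1 : Poly n) - (1 : Poly n) ⊗ₜ[ℂ] (X k : Poly n))
      (RingHom.ker π) (fun i => by
        simp only [hE, Matrix.of_apply]
        rw [← hc i, RingHom.mem_ker, map_sub, hπ, Algebra.TensorProduct.map_tmul,
          Algebra.TensorProduct.map_tmul,
          (hq _).2 (Ideal.subset_span ⟨i, rfl⟩ : φ i ∈ J φ), TensorProduct.zero_tmul,
          TensorProduct.tmul_zero, sub_zero]) k
    rw [RingHom.mem_ker, map_mul, map_sub, sub_mul] at h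
    exact sub_eq_zero.1 h
  have hpD : ∀ p : Poly n, π (p ⊗ₜ 1) * π E.det = π (1 ⊗ₜ p) * π E.det := by
    intro p
    obtain ⟨b, hb⟩ := exists_tmul_one_sub_one_tmul p
    rw [← sub_eq_zero, ← sub_mul, ← map_sub, hb, map_sum, Finset.sum_mul]
    refine Finset.sum_eq_zero fun k _ => ?_
    rw [map_mul, mul_assoc, map_sub, sub_mul, hXD, sub_self, mul_zero]
  refine ⟨ρl E.det, fun u hu => ?_⟩
  have hu' : ∀ j, q (X j * u) = 0 := fun j => (hq _).2 (hu j)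
  have hl : ∀ w, π (u ⊗ₜ 1) * π w = q u ⊗ₜ q (ρl w) := by
    intro w
    induction w using TensorProduct.induction_on with
    | zero => simp
    | add a b ha hb => rw [map_add, mul_add, ha, hb, map_add, map_add, TensorProduct.tmul_add]
    | tmul a b =>
      rw [hπ, Algebra.TensorProduct.map_tmul, Algebra.TensorProduct.map_tmul,
        Algebra.TensorProduct.tmul_mul_tmul, map_mul_of_socle q hu', hρl', map_one, one_mul,
        map_smul, TensorProduct.smul_tmul]
  have hr : ∀ w, π (1 ⊗ₜ u) * π w = q (ρr w) ⊗ₜ q u := by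
    intro w
    induction w using TensorProduct.induction_on with
    | zero => simp
    | add a b ha hb => rw [map_add, mul_add, ha, hb, map_add, map_add, TensorProduct.add_tmul]
    | tmul a b =>
      rw [hπ, Algebra.TensorProduct.map_tmul, Algebra.TensorProduct.map_tmul,
        Algebra.TensorProduct.tmul_mul_tmul, map_mul_of_socle q hu', hρr', map_one, one_mul,
        map_smul, TensorProduct.smul_tmul]
  have hne : q (ρr E.det) ≠ 0 := by
    rw [Ne, hq]
    have hdet : ρr E.det = (E.map ρr).det := AlgHom.map_det ρr E
    rw [hdet]
    refine det_notMem_J (N := N) _ (fun i => ?_) hN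
    have h := congrArg ρr (hc i)
    rw [map_sub, map_sum, hρr', hρr', h0, map_one, one_smul, zero_smul, sub_zero] at h
    rw [h]
    refine Finset.sum_congr rfl fun k _ => ?_
    rw [map_mul, map_sub, hρr', hρr', constantCoeff_X, map_one, one_smul, zero_smul, sub_zero]
    rfl
  obtain ⟨l, hl1⟩ : ∃ l : Module.Dual ℂ A, l (q (ρr E.det)) ≠ 0 := by
    by_contra hcon
    push Not at hcon
    exact hne ((Module.forall_dual_apply_eq_zero_iff ℂ _).1 hcon)
  refine ⟨(l (q (ρr E.det)))⁻¹ * l (q u), ?_⟩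
  have h := congrArg (fun w => TensorProduct.lid ℂ A (LinearMap.rTensor A l w))
    ((hl E.det).symm.trans ((hpD u).trans (hr E.det)))
  simp only [LinearMap.rTensor_tmul, TensorProduct.lid_tmul] at h
  rw [mul_smul, h, smul_smul, inv_mul_cancel₀ hl1, one_smul]

/-! ### The Jacobian determinant and the perfect pairing -/

theorem mem_J_of_large_degree {n N : ℕ} {φ : Fin n → Poly n} (hN : ∀ j, X j ^ (N + 1) ∈ J φ)
    {k : ℕ} (hk : n * N < k) {v : Poly n} (hv : v.IsHomogeneous k) : v ∈ J φ := by
  rw [v.as_sum]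
  refine Ideal.sum_mem _ fun α hα => ?_
  have hdeg : α.degree = k := by
    by_contra hne
    exact mem_support_iff.1 hα (hv.coeff_eq_zero hne)
  obtain ⟨i, hi⟩ : ∃ i, N + 1 ≤ α i := by
    by_contra hcon
    push Not at hcon
    have : ∑ i, α i ≤ ∑ _i : Fin n, N := Finset.sum_le_sum fun i _ => by have := hcon i; omega
    rw [Finset.sum_const, Finset.card_univ, Fintype.card_fin, smul_eq_mul,
      ← Finsupp.degree_eq_sum] at this
    omega
  have hle : Finsupp.single i (N + 1) ≤ α := Finsupp.single_le_iff.2 hi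
  have h : monomial α (coeff α v) =
      monomial (α - Finsupp.single i (N + 1)) (coeff α v) * X i ^ (N + 1) := by
    rw [X_pow_eq_monomial, monomial_mul, tsub_add_cancel_of_le hle, mul_one]
  rw [h]
  exact Ideal.mul_mem_left _ _ (hN i)

theorem homogeneousComponent_mem_J {n e : ℕ} {φ : Fin n → Poly n}
    (hφ : ∀ i, (φ i).IsHomogeneous e) {p : Poly n} (hp : p ∈ J φ) (k : ℕ) :
    homogeneousComponent k p ∈ J φ := by
  let _ : GradedAlgebra (homogeneousSubmodule (Fin n) ℂ) := gradedAlgebra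
  refine homogeneousComponent_mem_of_mem
    (Ideal.homogeneous_span (homogeneousSubmodule (Fin n) ℂ) _ ?_) hp k
  rintro _ ⟨i, rfl⟩
  exact ⟨e, hφ i⟩

theorem sum_pderiv_mul_X {n e : ℕ} {p : Poly n} (hp : p.IsHomogeneous e) :
    ∑ k, pderiv k p * X k = C (e : ℂ) * p := by
  simp only [mul_comm _ (X _)]
  rw [hp.sum_X_mul_pderiv, nsmul_eq_mul, map_natCast]

theorem X_mul_jac_mem {n e : ℕ} {φ : Fin n → Poly n} (hφ : ∀ i, (φ i).IsHomogeneous e)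
    (k : Fin n) : X k * jac φ ∈ J φ := by
  refine det_mul_mem_of_mulVec_mem _ X _ (fun i => ?_) k
  simp only [Matrix.of_apply]
  rw [sum_pderiv_mul_X (hφ i)]
  exact Ideal.mul_mem_left _ _ (Ideal.subset_span ⟨i, rfl⟩)

/-- By Euler's identity the Jacobian matrix takes `x` to `e φ`, so its determinant is, up to a
power of `e`, one of those treated in `det_notMem_J`. -/
theorem jac_notMem_J {n e N : ℕ} {φ : Fin n → Poly n} (he : e ≠ 0)
    (hφ : ∀ i, (φ i).IsHomogeneous e) (hN : ∀ j, X j ^ (N + 1) ∈ J φ) : jac φ ∉ J φ := by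
  intro hj
  refine det_notMem_J (φ := φ) ((C (e : ℂ)⁻¹ : Poly n) • Matrix.of fun i j => pderiv j (φ i))
    (fun i => ?_) hN ?_
  · simp only [Matrix.smul_apply, Matrix.of_apply, smul_eq_mul, mul_assoc]
    rw [← Finset.mul_sum, sum_pderiv_mul_X (hφ i), ← mul_assoc, ← map_mul,
      inv_mul_cancel₀ (Nat.cast_ne_zero.2 he), map_one, one_mul]
  · rw [Matrix.det_smul]
    exact Ideal.mul_mem_left _ _ hj

theorem jac_isHomogeneous {n e : ℕ} {φ : Fin n → Poly n} (hφ : ∀ i, (φ i).IsHomogeneous e) :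
    (jac φ).IsHomogeneous (n * (e - 1)) := by
  rw [jac, Matrix.det_apply]
  refine IsHomogeneous.sum _ _ _ fun σ _ => ?_
  have h : (∏ i, (Matrix.of fun i j => pderiv j (φ i)) (σ i) i).IsHomogeneous
      (∑ _i : Fin n, (e - 1)) :=
    IsHomogeneous.prod _ _ _ fun i _ => (hφ (σ i)).pderiv
  rw [Finset.sum_const, Finset.card_univ, Fintype.card_fin, smul_eq_mul] at h
  exact (homogeneousSubmodule _ _ _).smul_of_tower_mem (σ.sign : ℤ) h

/-- The socle of `M(φ)` is spanned by the class of the Jacobian determinant. -/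
theorem exists_sub_C_mul_jac_mem {n e N : ℕ} {φ : Fin n → Poly n} (he : e ≠ 0)
    (hφ : ∀ i, (φ i).IsHomogeneous e) (hN : ∀ j, X j ^ (N + 1) ∈ J φ) {u : Poly n}
    (hu : ∀ j, X j * u ∈ J φ) : ∃ c : ℂ, u - C c * jac φ ∈ J φ := by
  have h0 : ∀ i, constantCoeff (φ i) = 0 := fun i => by
    rw [constantCoeff_eq]
    exact (hφ i).coeff_eq_zero (by simpa using he.symm)
  obtain ⟨δ, hδ⟩ := exists_socle_generator (toM φ) (fun _ => toM_eq_zero_iff) h0 hN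
  obtain ⟨a, ha⟩ := hδ _ (X_mul_jac_mem hφ)
  obtain ⟨b, hb⟩ := hδ u hu
  have ha0 : a ≠ 0 := by
    rintro rfl
    rw [zero_smul, toM_eq_zero_iff] at ha
    exact jac_notMem_J he hφ hN ha
  refine ⟨b * a⁻¹, ?_⟩
  rw [← toM_eq_zero_iff, map_sub, ← smul_eq_C_mul, map_smul, ha, hb, smul_smul, mul_assoc,
    inv_mul_cancel₀ ha0, mul_one, sub_self]

/-- Every nonzero homogeneous element of `M(φ)` has a homogeneous multiple that is a nonzero
multiple of the class of the Jacobian determinant: multiply by variables as long as possible. -/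
theorem exists_mul_sub_C_mul_jac_mem {n e N : ℕ} {φ : Fin n → Poly n} (he : e ≠ 0)
    (hφ : ∀ i, (φ i).IsHomogeneous e) (hN : ∀ j, X j ^ (N + 1) ∈ J φ) {k : ℕ} {v : Poly n}
    (hv : v.IsHomogeneous k) (hvJ : v ∉ J φ) :
    ∃ j, j + k = n * (e - 1) ∧ ∃ r : Poly n, r.IsHomogeneous j ∧
      ∃ c : ℂ, c ≠ 0 ∧ r * v - C c * jac φ ∈ J φ := by
  obtain ⟨m, hm⟩ : ∃ m, n * N < k + m := ⟨n * N + 1, by omega⟩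
  induction m generalizing k v with
  | zero => exact absurd (mem_J_of_large_degree hN hm hv) hvJ
  | succ m ih =>
    by_cases hsoc : ∀ j, X j * v ∈ J φ
    · obtain ⟨c, hc⟩ := exists_sub_C_mul_jac_mem he hφ hN hsoc
      have hk : k = n * (e - 1) := by
        by_contra hne
        have h := homogeneousComponent_mem_J hφ hc k
        rw [map_sub, homogeneousComponent_C_mul, homogeneousComponent_eq_self hv,
          homogeneousComponent_of_mem (jac_isHomogeneous hφ), if_neg hne, mul_zero, sub_zero] at h
        exact hvJ h
      refine ⟨0, by omega, 1, isHomogeneous_one _ _, c, ?_, by rwa [one_mul]⟩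
      rintro rfl
      rw [C_0, zero_mul, sub_zero] at hc
      exact hvJ hc
    · push Not at hsoc
      obtain ⟨i, hi⟩ := hsoc
      obtain ⟨j, hj, r, hr, c, hc, hmem⟩ :=
        ih ((isHomogeneous_X ℂ i).mul hv) hi (by omega)
      exact ⟨j + 1, by omega, r * X i, hr.mul (isHomogeneous_X ℂ i), c, hc, by rwa [mul_assoc]⟩

/-- Perfectness of the pairing `M(φ)_j × M(φ)_k → ℂ`, `j + k = n (e - 1)`, given by a functional
`τ` on `M(φ)` that does not vanish on the Jacobian determinant. -/
theorem mem_J_of_pairing_eq_zero {n e N : ℕ} {φ : Fin n → Poly n} (he : e ≠ 0)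
    (hφ : ∀ i, (φ i).IsHomogeneous e) (hN : ∀ j, X j ^ (N + 1) ∈ J φ)
    {τ : Poly n →ₗ[ℂ] ℂ} (hτ : ∀ p ∈ J φ, τ p = 0) (hτj : τ (jac φ) ≠ 0)
    {j k : ℕ} (hjk : j + k = n * (e - 1)) {v : Poly n} (hv : v.IsHomogeneous k)
    (h : ∀ r : Poly n, r.IsHomogeneous j → τ (r * v) = 0) : v ∈ J φ := by
  by_contra hvJ
  obtain ⟨j', hj', r, hr, c, hc, hmem⟩ := exists_mul_sub_C_mul_jac_mem he hφ hN hv hvJ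
  obtain rfl : j' = j := by omega
  have h1 := hτ _ hmem
  rw [map_sub, h r hr, ← smul_eq_C_mul, map_smul, smul_eq_mul, zero_sub, neg_eq_zero] at h1
  exact mul_ne_zero hc hτj h1

/-! ### Smoothness and powers of the variables -/

/-- By the Nullstellensatz, forms without a common zero in projective space generate an ideal that
contains powers of all the variables. -/
theorem exists_X_pow_mem_J {n : ℕ} {φ : Fin n → Poly n}
    (h : ∀ p : Fin n → ℂ, p ≠ 0 → ∃ i, eval p (φ i) ≠ 0) :
    ∃ N, ∀ j, X j ^ (N + 1) ∈ J φ := by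
  have hrad : ∀ j, (X j : Poly n) ∈ (J φ).radical := by
    intro j
    rw [← vanishingIdeal_zeroLocus_eq_radical (K := ℂ), mem_vanishingIdeal_iff]
    intro p hp
    have hp0 : p = 0 := by
      by_contra hne
      obtain ⟨i, hi⟩ := h p hne
      exact hi (hp (φ i) (Ideal.subset_span ⟨i, rfl⟩))
    simp [hp0]
  choose m hm using hrad
  refine ⟨∑ j, m j, fun j => ?_⟩
  have hle : m j ≤ ∑ j, m j + 1 :=
    (Finset.single_le_sum (fun _ _ => Nat.zero_le _) (Finset.mem_univ j)).trans (Nat.le_succ _)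
  exact Ideal.pow_mem_of_pow_mem _ (hm j) hle

theorem exists_X_pow_mem_J_gradient {n d : ℕ} (hd : d ≠ 0) {f : Poly n} (hf : f.IsHomogeneous d)
    (hs : IsSmoothHypersurface f) : ∃ N, ∀ j, X j ^ (N + 1) ∈ J (gradient f) := by
  refine exists_X_pow_mem_J fun p hp => ?_
  by_contra hcon
  push Not at hcon
  have hE := congrArg (eval p) (sum_pderiv_mul_X hf)
  rw [map_sum, Finset.sum_eq_zero (fun k _ => by
    rw [map_mul]
    exact mul_eq_zero_of_left (hcon k) _), map_mul, eval_C] at hE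
  have hf0 : eval p f = 0 :=
    (mul_eq_zero.1 hE.symm).resolve_left (Nat.cast_ne_zero.2 hd)
  obtain ⟨i, hi⟩ := hs p hp hf0
  exact hi (hcon i)

theorem isSmoothHypersurface_of_X_pow_mem {n N : ℕ} {f : Poly n}
    (h : ∀ j, X j ^ N ∈ J (gradient f)) : IsSmoothHypersurface f := by
  intro p hp _
  by_contra hcon
  push Not at hcon
  have hle : J (gradient f) ≤ RingHom.ker (eval p) := by
    rw [J, Ideal.span_le]
    rintro _ ⟨i, rfl⟩
    exact hcon i
  refine hp (funext fun j => ?_)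
  have h1 := hle (h j)
  rw [RingHom.mem_ker, map_pow, eval_X] at h1
  exact eq_zero_of_pow_eq_zero h1

/-! ### Linear forms and dual forms -/

/-- The linear form `y_1 x_1 + ⋯ + y_n x_n`. -/
def linForm {n : ℕ} (y : Fin n → ℂ) : Poly n := ∑ i, C (y i) * X i

theorem linForm_isHomogeneous {n : ℕ} (y : Fin n → ℂ) : (linForm y).IsHomogeneous 1 :=
  IsHomogeneous.sum _ _ _ fun i _ => isHomogeneous_C_mul_X (y i) i

theorem coeff_linForm {n : ℕ} (y : Fin n → ℂ) (i : Fin n) :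
    coeff (Finsupp.single i 1) (linForm y) = y i := by
  rw [linForm, coeff_sum, Finset.sum_eq_single i]
  · rw [coeff_C_mul, coeff_X, if_pos rfl, mul_one]
  · intro j _ hj
    rw [coeff_C_mul, coeff_X, if_neg, mul_zero]
    exact fun h => hj (Finsupp.single_left_injective one_ne_zero h)
  · simp

theorem linForm_ne_zero {n : ℕ} {y : Fin n → ℂ} (hy : y ≠ 0) : linForm y ≠ 0 := by
  intro h
  refine hy (funext fun i => ?_)
  rw [← coeff_linForm y i, h, coeff_zero, Pi.zero_apply]

theorem exists_eq_linForm {n : ℕ} {p : Poly n} (hp : p.IsHomogeneous 1) :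
    ∃ y, p = linForm y := by
  have h : p ∈ homogeneousSubmodule (Fin n) ℂ 1 := hp
  rw [homogeneousSubmodule_one_eq_span_X, Submodule.mem_span_range_iff_exists_fun] at h
  obtain ⟨y, hy⟩ := h
  exact ⟨y, by simp only [linForm, ← smul_eq_C_mul, hy]⟩

theorem toM_linForm {n : ℕ} (φ : Fin n → Poly n) (y : Fin n → ℂ) :
    toM φ (linForm y) = ∑ i, y i • toM φ (X i) := by
  simp only [linForm, ← smul_eq_C_mul, map_sum, map_smul]

theorem map_mul_linForm {n : ℕ} (τ : Poly n →ₗ[ℂ] ℂ) (p : Poly n) (y : Fin n → ℂ) :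
    τ (p * linForm y) = ∑ i, τ (X i * p) * y i := by
  rw [linForm, Finset.mul_sum, map_sum]
  refine Finset.sum_congr rfl fun i _ => ?_
  rw [show p * (C (y i) * X i) = y i • (X i * p) by rw [smul_eq_C_mul]; ring, map_smul,
    smul_eq_mul, mul_comm]

/-- The linear form `y_1 x_1 + ⋯ + y_n x_n` with indeterminate coefficients `y_i`, as a polynomial
in `y` over the polynomial ring in `x`. -/
def genericLinForm (n : ℕ) : MvPolynomial (Fin n) (Poly n) := ∑ i, C (X i) * X i

/-- The form `y ↦ τ((y_1 x_1 + ⋯ + y_n x_n)^m)` attached to a linear functional `τ` on the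
polynomial ring: `τ` is applied to the coefficients of the power of the generic linear form. -/
def dualForm {n : ℕ} (τ : Poly n →ₗ[ℂ] ℂ) (m : ℕ) : Poly n :=
  ∑ α ∈ (genericLinForm n ^ m).support, monomial α (τ (coeff α (genericLinForm n ^ m)))

theorem coeff_dualForm {n : ℕ} (τ : Poly n →ₗ[ℂ] ℂ) (m : ℕ) (α : Fin n →₀ ℕ) :
    coeff α (dualForm τ m) = τ (coeff α (genericLinForm n ^ m)) := by
  rw [dualForm, coeff_sum]
  simp only [coeff_monomial]
  rw [Finset.sum_ite_eq' _ α]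
  split_ifs with h
  · rfl
  · rw [notMem_support_iff.1 h, map_zero]

theorem genericLinForm_pow_isHomogeneous (n m : ℕ) :
    (genericLinForm n ^ m).IsHomogeneous m := by
  have h : (genericLinForm n).IsHomogeneous 1 :=
    IsHomogeneous.sum _ _ _ fun i _ => isHomogeneous_C_mul_X _ i
  simpa using h.pow m

theorem dualForm_isHomogeneous {n : ℕ} (τ : Poly n →ₗ[ℂ] ℂ) (m : ℕ) :
    (dualForm τ m).IsHomogeneous m :=
  IsHomogeneous.sum _ _ _ fun α hα => isHomogeneous_monomial _ (by
    by_contra hne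
    exact mem_support_iff.1 hα ((genericLinForm_pow_isHomogeneous n m).coeff_eq_zero hne))

theorem eval_dualForm {n : ℕ} (τ : Poly n →ₗ[ℂ] ℂ) (m : ℕ) (y : Fin n → ℂ) :
    eval y (dualForm τ m) = τ (linForm y ^ m) := by
  have h : linForm y ^ m = eval (fun i => C (y i)) (genericLinForm n ^ m) := by
    rw [map_pow, genericLinForm, map_sum, linForm]
    congr 1
    refine Finset.sum_congr rfl fun i _ => ?_
    rw [map_mul, eval_C, eval_X, mul_comm]
  rw [h, dualForm, map_sum, eval_eq, map_sum]
  refine Finset.sum_congr rfl fun α _ => ?_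
  rw [eval_monomial, mul_comm (coeff α _)]
  simp only [← C_pow, ← map_prod]
  rw [← smul_eq_C_mul, map_smul, smul_eq_mul, mul_comm, Finsupp.prod_fintype _ _ (by simp)]
  congr 1
  refine (Finset.prod_subset (Finset.subset_univ _) fun i _ hi => ?_).symm
  rw [Finsupp.notMem_support_iff.1 hi, pow_zero]

theorem pderiv_dualForm {n : ℕ} (τ : Poly n →ₗ[ℂ] ℂ) (m : ℕ) (i : Fin n) :
    pderiv i (dualForm τ (m + 1)) =
      C ((m : ℂ) + 1) * dualForm (τ ∘ₗ LinearMap.mulLeft ℂ (X i)) m := by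
  have h : pderiv i (genericLinForm n ^ (m + 1)) =
      C (C ((m : ℂ) + 1) * X i) * genericLinForm n ^ m := by
    have h1 : pderiv i (genericLinForm n) = C (X i) := by
      rw [genericLinForm, map_sum, Finset.sum_eq_single i]
      · rw [pderiv_C_mul, pderiv_X_self, mul_one]
      · intro j _ hj
        rw [pderiv_C_mul, pderiv_X_of_ne hj, mul_zero]
      · simp
    rw [pderiv_pow, h1, Nat.add_sub_cancel]
    simp only [map_mul, map_add, map_natCast, map_one, Nat.cast_add, Nat.cast_one]
    ring
  ext α
  have h2 := congrArg (coeff α) h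
  rw [coeff_pderiv, coeff_C_mul] at h2
  rw [coeff_pderiv, coeff_dualForm, coeff_C_mul, coeff_dualForm, LinearMap.comp_apply,
    LinearMap.mulLeft_apply, ← smul_eq_mul (a := (m : ℂ) + 1), ← map_smul, smul_eq_C_mul,
    ← mul_assoc, ← h2, mul_comm, ← smul_eq_mul, ← map_smul, smul_eq_C_mul, mul_comm]
  congr 2
  simp

theorem eval_pderiv_dualForm {n : ℕ} (τ : Poly n →ₗ[ℂ] ℂ) (m : ℕ) (i : Fin n) (y : Fin n → ℂ) :
    eval y (pderiv i (dualForm τ (m + 1))) = (m + 1) * τ (X i * linForm y ^ m) := by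
  rw [pderiv_dualForm, map_mul, eval_C, eval_dualForm]
  rfl

/-! ### Open conditions on the coefficients of a form -/

/-- The form of degree `m` with indeterminate coefficients, the coefficient of `x^α` being the
indeterminate `X α`. -/
def genericForm (n m : ℕ) : MvPolynomial (Fin n) (MvPolynomial (Fin n →₀ ℕ) ℂ) :=
  ∑ α ∈ Finset.univ.finsuppAntidiag m, monomial α (X α)

/-- The substitution of the coefficients of `g` for the indeterminate coefficients. -/
def specialize {n : ℕ} (g : Poly n) :
    MvPolynomial (Fin n) (MvPolynomial (Fin n →₀ ℕ) ℂ) →+* Poly n :=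
  MvPolynomial.map (eval fun α => coeff α g)

theorem mem_finsuppAntidiag_univ {n m : ℕ} {α : Fin n →₀ ℕ} :
    α ∈ Finset.univ.finsuppAntidiag m ↔ α.degree = m := by
  rw [Finset.mem_finsuppAntidiag, Finsupp.degree_eq_sum]
  simp

theorem specialize_genericForm {n m : ℕ} {g : Poly n} (hg : g.IsHomogeneous m) :
    specialize g (genericForm n m) = g := by
  rw [specialize, genericForm, map_sum]
  simp only [map_monomial, eval_X]
  ext β
  rw [coeff_sum]
  simp only [coeff_monomial]
  rw [Finset.sum_ite_eq' _ β]
  split_ifs with h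
  · rfl
  · exact (hg.coeff_eq_zero fun hd => h (mem_finsuppAntidiag_univ.2 hd)).symm

theorem specialize_map_C {n : ℕ} (g p : Poly n) : specialize g (MvPolynomial.map C p) = p := by
  rw [specialize, MvPolynomial.map_map]
  convert MvPolynomial.map_id p
  ext
  simp

theorem specialize_pderiv {n : ℕ} (g : Poly n) (i : Fin n)
    (F : MvPolynomial (Fin n) (MvPolynomial (Fin n →₀ ℕ) ℂ)) :
    specialize g (pderiv i F) = pderiv i (specialize g F) := pderiv_map.symm

theorem forms_le_of_monomial_mem {n N : ℕ} {W : Submodule ℂ (Poly n)}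
    (h : ∀ α : Fin n →₀ ℕ, α.degree = N → monomial α (1 : ℂ) ∈ W) : Forms n N ≤ W := by
  intro p hp
  rw [p.as_sum]
  refine W.sum_mem fun α hα => ?_
  rw [← mul_one (coeff α p), ← smul_eq_mul, ← smul_monomial]
  refine W.smul_mem _ (h α ?_)
  by_contra hne
  exact mem_support_iff.1 hα (IsHomogeneous.coeff_eq_zero hp hne)

/-- For a family of forms of degree `N` that depend polynomially on the coefficients of `g`, it is
a Zariski open condition on `g` that the family spans all forms of degree `N`. If each monomial is
a combination of the forms at `g₀`, the same combinations at `g` have a coefficient matrix that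
depends polynomially on `g`, and its determinant is `1` at `g₀`. -/
theorem exists_eval_ne_zero_imp_forms_le_span {n m N : ℕ} {K : Type*}
    (V : K → MvPolynomial (Fin n) (MvPolynomial (Fin n →₀ ℕ) ℂ))
    (hV : ∀ g ∈ Forms n m, ∀ k, (specialize g (V k)).IsHomogeneous N) (g₀ : Poly n)
    (h₀ : Forms n N ≤ Submodule.span ℂ (Set.range fun k => specialize g₀ (V k))) :
    ∃ P : MvPolynomial (Fin n →₀ ℕ) ℂ, eval (fun α => coeff α g₀) P ≠ 0 ∧
      ∀ g ∈ Forms n m, eval (fun α => coeff α g) P ≠ 0 →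
        Forms n N ≤ Submodule.span ℂ (Set.range fun k => specialize g (V k)) := by
  classical
  let ι := {α : Fin n →₀ ℕ // α ∈ (Finset.univ : Finset (Fin n)).finsuppAntidiag N}
  have hc : ∀ α : ι, ∃ c : K →₀ ℂ,
      (c.sum fun k a => a • specialize g₀ (V k)) = monomial α.1 1 := fun α =>
    Finsupp.mem_span_range_iff_exists_finsupp.1
      (h₀ (isHomogeneous_monomial 1 (mem_finsuppAntidiag_univ.1 α.2)))
  choose c hc using hc
  let W : ι → MvPolynomial (Fin n) (MvPolynomial (Fin n →₀ ℕ) ℂ) := fun α =>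
    ∑ k ∈ (c α).support, C (C (c α k)) * V k
  have hW : ∀ g α, specialize g (W α) = ∑ k ∈ (c α).support, c α k • specialize g (V k) := by
    intro g α
    simp only [W, map_sum, map_mul, smul_eq_C_mul]
    refine Finset.sum_congr rfl fun k _ => ?_
    congr 1
    rw [specialize, map_C, eval_C]
  let Q : Matrix ι ι (MvPolynomial (Fin n →₀ ℕ) ℂ) := Matrix.of fun α β => coeff β.1 (W α)
  have hQ : ∀ g : Poly n, eval (fun α => coeff α g) Q.det =
      (Matrix.of fun α β : ι => coeff β.1 (specialize g (W α))).det := by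
    intro g
    rw [RingHom.map_det]
    congr 1
  refine ⟨Q.det, ?_, fun g hg hP => ?_⟩
  · rw [hQ]
    have h1 : (Matrix.of fun α β : ι => coeff β.1 (specialize g₀ (W α))) = 1 := by
      ext α β
      have hα : specialize g₀ (W α) = monomial α.1 1 := (hW g₀ α).trans (hc α)
      rw [Matrix.of_apply, hα, coeff_monomial, Matrix.one_apply]
      exact if_congr Subtype.ext_iff.symm rfl rfl
    rw [h1, Matrix.det_one]
    exact one_ne_zero
  · rw [hQ] at hP
    set B : Matrix ι ι ℂ := Matrix.of fun α β : ι => coeff β.1 (specialize g (W α)) with hB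
    have hWmem : ∀ α, specialize g (W α) ∈
        Submodule.span ℂ (Set.range fun k => specialize g (V k)) := by
      intro α
      rw [hW]
      exact Submodule.sum_mem _ fun k _ =>
        Submodule.smul_mem _ _ (Submodule.subset_span ⟨k, rfl⟩)
    have hWhom : ∀ α, specialize g (W α) ∈ Forms n N := by
      intro α
      rw [hW]
      exact Submodule.sum_mem _ fun k _ => Submodule.smul_mem _ _ (hV g hg k)
    refine forms_le_of_monomial_mem fun β hβ => ?_
    have hβ' : β ∈ (Finset.univ : Finset (Fin n)).finsuppAntidiag N :=
      mem_finsuppAntidiag_univ.2 hβ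
    have key : monomial β (1 : ℂ) = ∑ α : ι, B⁻¹ ⟨β, hβ'⟩ α • specialize g (W α) := by
      ext γ
      by_cases hγ : γ.degree = N
      · have hinv : B⁻¹ * B = 1 := Matrix.nonsing_inv_mul _ (isUnit_iff_ne_zero.2 hP)
        have h2 := congrFun (congrFun hinv ⟨β, hβ'⟩) ⟨γ, mem_finsuppAntidiag_univ.2 hγ⟩
        rw [Matrix.mul_apply, Matrix.one_apply] at h2
        rw [coeff_sum, coeff_monomial]
        simp only [coeff_smul, smul_eq_mul]
        simp only [hB, Matrix.of_apply, Subtype.mk.injEq] at h2 ⊢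
        exact h2.symm
      · have hr : ∑ α : ι, B⁻¹ ⟨β, hβ'⟩ α • specialize g (W α) ∈ Forms n N :=
          Submodule.sum_mem _ fun α _ => Submodule.smul_mem _ _ (hWhom α)
        rw [(isHomogeneous_monomial (1 : ℂ) hβ).coeff_eq_zero hγ,
          IsHomogeneous.coeff_eq_zero hr hγ]
    rw [key]
    exact Submodule.sum_mem _ fun α _ => Submodule.smul_mem _ _ (hWmem α)

/-- A form in `J(φ)` is a combination of multiples of the `φ_i` by monomials of the
complementary degree. -/
theorem mem_span_of_mem_J {n e N : ℕ} {φ : Fin n → Poly n} (hφ : ∀ i, (φ i).IsHomogeneous e)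
    {h : Poly n} (hh : h.IsHomogeneous (N + e)) (hJ : h ∈ J φ) :
    h ∈ Submodule.span ℂ (Set.range fun k : Fin n × {α : Fin n →₀ ℕ // α.degree = N} =>
      monomial k.2.1 (1 : ℂ) * φ k.1) := by
  obtain ⟨c, hc⟩ := Ideal.mem_span_range_iff_exists_fun.1 hJ
  have h1 : h = ∑ i, homogeneousComponent N (c i) * φ i := by
    let _ : GradedAlgebra (homogeneousSubmodule (Fin n) ℂ) := gradedAlgebra
    have hdec : ∀ (k : ℕ) (p : Poly n),
        (DirectSum.decompose (homogeneousSubmodule (Fin n) ℂ) p k : Poly n) =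
          homogeneousComponent k p := fun k p => decomposition.decompose'_apply p k
    rw [← homogeneousComponent_eq_self hh, ← hc, map_sum]
    refine Finset.sum_congr rfl fun i _ => ?_
    rw [← hdec, ← hdec]
    exact DirectSum.coe_decompose_mul_add_of_right_mem _ (hφ i)
  rw [h1]
  refine Submodule.sum_mem _ fun i _ => ?_
  have hle : Forms n N ≤ (Submodule.span ℂ (Set.range fun k : Fin n ×
      {α : Fin n →₀ ℕ // α.degree = N} => monomial k.2.1 (1 : ℂ) * φ k.1)).comap
        (LinearMap.mulRight ℂ (φ i)) :=
    forms_le_of_monomial_mem fun α hα => Submodule.subset_span ⟨⟨i, α, hα⟩, rfl⟩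
  exact hle (homogeneousComponent_isHomogeneous N (c i))

/-! ### The strong Lefschetz property in degree one -/

/-- Multiplication by `ℓ^t` maps `M(φ)_1` onto `M(φ)_{t+1}`. The condition is stated on
representatives in the polynomial ring. -/
def PowMulSurjective {n : ℕ} (φ : Fin n → Poly n) (t : ℕ) (ℓ : Poly n) : Prop :=
  ∀ g : Poly n, g.IsHomogeneous (t + 1) → ∃ s : Poly n, s.IsHomogeneous 1 ∧ g - ℓ ^ t * s ∈ J φ

theorem exists_functional {n : ℕ} {φ : Fin n → Poly n} {p : Poly n} (hp : p ∉ J φ) :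
    ∃ τ : Poly n →ₗ[ℂ] ℂ, (∀ q ∈ J φ, τ q = 0) ∧ τ p ≠ 0 := by
  obtain ⟨l, hl⟩ : ∃ l : Module.Dual ℂ (M φ), l (toM φ p) ≠ 0 := by
    by_contra hcon
    push Not at hcon
    exact hp (toM_eq_zero_iff.1 ((Module.forall_dual_apply_eq_zero_iff ℂ _).1 hcon))
  refine ⟨l ∘ₗ (toM φ).toLinearMap, fun q hq => ?_, hl⟩
  rw [LinearMap.comp_apply, AlgHom.toLinearMap_apply, toM_eq_zero_iff.2 hq, map_zero]

theorem mem_J_of_X_mul_eq_zero {n e N t : ℕ} {φ : Fin n → Poly n} (he : e ≠ 0)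
    (hφ : ∀ i, (φ i).IsHomogeneous e) (hN : ∀ j, X j ^ (N + 1) ∈ J φ)
    (ht : n * (e - 1) = t + 2) {τ : Poly n →ₗ[ℂ] ℂ} (hτ : ∀ p ∈ J φ, τ p = 0)
    (hτj : τ (jac φ) ≠ 0) {v : Poly n} (hv : v.IsHomogeneous (t + 1))
    (h : ∀ i, τ (X i * v) = 0) : v ∈ J φ := by
  refine mem_J_of_pairing_eq_zero he hφ hN hτ hτj (j := 1) (by omega) hv fun r hr => ?_
  obtain ⟨y, rfl⟩ := exists_eq_linForm hr
  rw [mul_comm, map_mul_linForm]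
  exact Finset.sum_eq_zero fun i _ => by rw [h, zero_mul]

theorem powMulSurjective_of_det_ne_zero {n e N t : ℕ} {φ : Fin n → Poly n} (he : e ≠ 0)
    (hφ : ∀ i, (φ i).IsHomogeneous e) (hN : ∀ j, X j ^ (N + 1) ∈ J φ)
    (ht : n * (e - 1) = t + 2) {τ : Poly n →ₗ[ℂ] ℂ} (hτ : ∀ p ∈ J φ, τ p = 0)
    (hτj : τ (jac φ) ≠ 0) {ℓ : Poly n} (hℓ : ℓ.IsHomogeneous 1)
    (hdet : (Matrix.of fun i j => τ (X j * (X i * ℓ ^ t))).det ≠ 0) :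
    PowMulSurjective φ t ℓ := by
  intro g hg
  set B : Matrix (Fin n) (Fin n) ℂ := Matrix.of fun i j => τ (X j * (X i * ℓ ^ t)) with hB
  set s : Fin n → ℂ := B⁻¹.mulVec fun i => τ (X i * g) with hs
  have hBs : B.mulVec s = fun i => τ (X i * g) := by
    rw [hs, Matrix.mulVec_mulVec, Matrix.mul_nonsing_inv _ (isUnit_iff_ne_zero.2 hdet),
      Matrix.one_mulVec]
  have hpow : (ℓ ^ t).IsHomogeneous t := by simpa using hℓ.pow t
  refine ⟨linForm s, linForm_isHomogeneous s, mem_J_of_X_mul_eq_zero he hφ hN ht hτ hτj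
    (hg.sub (hpow.mul (linForm_isHomogeneous s))) fun i => ?_⟩
  rw [mul_sub, map_sub, ← mul_assoc, map_mul_linForm, ← congrFun hBs i]
  exact sub_self _

/-- If multiplication by `ℓ^(T-2)` maps `M(φ)_1` onto `M(φ)_{T-1}` for one linear form `ℓ`, then
the SLP holds in degree `1`. Surjectivity is an open condition on `ℓ`, and it implies injectivity:
if `ℓ^(T-2) p = 0`, then `p` annihilates `ℓ^(T-2) M(φ)_1 = M(φ)_{T-1}`, so `p = 0` by the
perfect pairing. -/
theorem slpInDegree_one_of_powMulSurjective {n e N t : ℕ} {φ : Fin n → Poly n} (he : e ≠ 0)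
    (hφ : ∀ i, (φ i).IsHomogeneous e) (hN : ∀ j, X j ^ (N + 1) ∈ J φ)
    (ht : n * (e - 1) = t + 2) {ℓ₀ : Poly n} (hℓ₀ : ℓ₀.IsHomogeneous 1)
    (hsurj : PowMulSurjective φ t ℓ₀) : SLPInDegree φ (t + 2) 1 := by
  let V : {h : Poly n // h.IsHomogeneous (t + 1) ∧ h ∈ J φ} ⊕ Fin n →
      MvPolynomial (Fin n) (MvPolynomial (Fin n →₀ ℕ) ℂ) :=
    Sum.elim (fun h => MvPolynomial.map C h.1) (fun j => genericForm n 1 ^ t * X j)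
  have hVl : ∀ g h, specialize g (V (Sum.inl h)) = h.1 := fun g h => specialize_map_C g h.1
  have hVr : ∀ g : Poly n, g.IsHomogeneous 1 → ∀ j, specialize g (V (Sum.inr j)) = g ^ t * X j := by
    intro g hg j
    simp only [V, Sum.elim_inr]
    rw [map_mul, map_pow, specialize_genericForm hg, specialize, map_X]
  have hpow : ∀ {g : Poly n}, g.IsHomogeneous 1 → (g ^ t).IsHomogeneous t := fun hg => by
    simpa using hg.pow t
  obtain ⟨P, hP₀, hP⟩ := exists_eval_ne_zero_imp_forms_le_span (m := 1) (N := t + 1) V (by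
    rintro g hg (h | j)
    · rw [hVl]
      exact h.2.1
    · rw [hVr g hg]
      exact (hpow hg).mul (isHomogeneous_X ℂ j)) ℓ₀ (by
    intro g hg
    obtain ⟨s, hs, hmem⟩ := hsurj g hg
    obtain ⟨y, rfl⟩ := exists_eq_linForm hs
    have hl : g - ℓ₀ ^ t * linForm y ∈
        Submodule.span ℂ (Set.range fun k => specialize ℓ₀ (V k)) :=
      Submodule.subset_span ⟨Sum.inl ⟨_, IsHomogeneous.sub hg ((hpow hℓ₀).mul hs), hmem⟩, hVl _ _⟩
    have hr : ℓ₀ ^ t * linForm y ∈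
        Submodule.span ℂ (Set.range fun k => specialize ℓ₀ (V k)) := by
      rw [linForm, Finset.mul_sum]
      refine Submodule.sum_mem _ fun j _ => ?_
      rw [mul_left_comm, ← smul_eq_C_mul]
      exact Submodule.smul_mem _ _ (Submodule.subset_span ⟨Sum.inr j, hVr _ hℓ₀ j⟩)
    simpa using Submodule.add_mem _ hl hr)
  refine ⟨P, ⟨ℓ₀, hℓ₀, hP₀⟩, fun ℓ hℓ hPℓ => ?_⟩
  have hsurjℓ : PowMulSurjective φ t ℓ := by
    intro g hg
    have hle : Submodule.span ℂ (Set.range fun k => specialize ℓ (V k)) ≤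
        (J φ).restrictScalars ℂ ⊔ (Forms n 1).map (LinearMap.mulLeft ℂ (ℓ ^ t)) := by
      rw [Submodule.span_le]
      rintro _ ⟨h | j, rfl⟩
      · refine Submodule.mem_sup_left ?_
        simp only [hVl]
        exact h.2.2
      · refine Submodule.mem_sup_right ⟨X j, isHomogeneous_X ℂ j, ?_⟩
        exact (hVr ℓ hℓ j).symm
    obtain ⟨a, ha, _, ⟨s, hs, rfl⟩, hab⟩ := Submodule.mem_sup.1 (hle (hP ℓ hℓ hPℓ hg))
    refine ⟨s, hs, ?_⟩
    rw [← hab, LinearMap.mulLeft_apply, add_sub_cancel_right]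
    exact ha
  have hT : t + 2 - 2 * 1 = t := by omega
  have hT' : t + 2 - 1 = t + 1 := by omega
  rw [hT, hT']
  refine ⟨?_, ?_, ?_⟩
  · rintro _ ⟨p, hp, rfl⟩
    refine ⟨ℓ ^ t * p, (hpow hℓ).mul hp, ?_⟩
    simp
  · rintro _ ⟨p, hp, rfl⟩ _ ⟨p', hp', rfl⟩ h
    simp only [AlgHom.toLinearMap_apply] at h ⊢
    obtain ⟨τ, hτ, hτj⟩ := exists_functional (jac_notMem_J he hφ hN)
    rw [← sub_eq_zero, ← map_sub, toM_eq_zero_iff]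
    rw [← map_pow, ← map_mul, ← map_mul, ← sub_eq_zero, ← map_sub, toM_eq_zero_iff,
      ← mul_sub] at h
    refine mem_J_of_pairing_eq_zero he hφ hN hτ hτj (j := t + 1) (k := 1) (by omega)
      (IsHomogeneous.sub hp hp') fun r hr => hτ _ ?_
    obtain ⟨s, -, hs⟩ := hsurjℓ r hr
    have h1 := (J φ).add_mem (Ideal.mul_mem_right (p - p') _ hs) (Ideal.mul_mem_left _ s h)
    rwa [show (r - ℓ ^ t * s) * (p - p') + s * (ℓ ^ t * (p - p')) = r * (p - p') by ring] at h1
  · rintro _ ⟨g, hg, rfl⟩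
    obtain ⟨s, hs, hmem⟩ := hsurjℓ g hg
    refine ⟨toM φ s, ⟨s, hs, rfl⟩, ?_⟩
    rw [← toM_eq_zero_iff, map_sub, sub_eq_zero, map_mul, map_pow] at hmem
    exact hmem.symm

/-- If no power `ℓ^(T-1)` of a nonzero linear form lies in `J(φ)`, then `ℓ^(T-2)` is surjective
for some `ℓ`. The forms `y ↦ τ(x_i ℓ_y^(T-1))` have no common zero, by the perfect pairing. Hence
their Jacobian determinant is not zero (`jac_notMem_J`), and its entries are the numbers
`τ(x_i x_j ℓ_y^(T-2))` up to a constant. -/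
theorem exists_powMulSurjective {n e N t : ℕ} {φ : Fin n → Poly n} (he : e ≠ 0)
    (hφ : ∀ i, (φ i).IsHomogeneous e) (hN : ∀ j, X j ^ (N + 1) ∈ J φ)
    (ht : n * (e - 1) = t + 2) (hℓ : ∀ y : Fin n → ℂ, y ≠ 0 → linForm y ^ (t + 1) ∉ J φ) :
    ∃ y, PowMulSurjective φ t (linForm y) := by
  obtain ⟨τ, hτ, hτj⟩ := exists_functional (jac_notMem_J he hφ hN)
  set ψ : Fin n → Poly n := fun i => dualForm (τ ∘ₗ LinearMap.mulLeft ℂ (X i)) (t + 1) with hψ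
  obtain ⟨N', hN'⟩ : ∃ N', ∀ j, X j ^ (N' + 1) ∈ J ψ := by
    refine exists_X_pow_mem_J fun y hy => ?_
    by_contra hcon
    push Not at hcon
    refine hℓ y hy (mem_J_of_X_mul_eq_zero he hφ hN ht hτ hτj
      (by simpa using (linForm_isHomogeneous y).pow (t + 1)) fun i => ?_)
    have h := hcon i
    rwa [hψ, eval_dualForm] at h
  have hjac : jac ψ ≠ 0 := fun h0 =>
    jac_notMem_J (Nat.succ_ne_zero t) (fun i => dualForm_isHomogeneous _ _) hN'
      (h0 ▸ (J ψ).zero_mem)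
  obtain ⟨y, hy⟩ : ∃ y, eval y (jac ψ) ≠ 0 := by
    by_contra hcon
    push Not at hcon
    exact hjac (MvPolynomial.funext fun y => by rw [hcon, map_zero])
  refine ⟨y, powMulSurjective_of_det_ne_zero he hφ hN ht hτ hτj (linForm_isHomogeneous y) ?_⟩
  intro hdet
  refine hy ?_
  have hM : (eval y).mapMatrix (Matrix.of fun i j => pderiv j (ψ i)) =
      ((t : ℂ) + 1) • (Matrix.of fun i j => τ (X j * (X i * linForm y ^ t))).transpose := by
    ext i j
    rw [RingHom.mapMatrix_apply, Matrix.map_apply, Matrix.of_apply, hψ, eval_pderiv_dualForm]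
    rfl
  rw [jac, RingHom.map_det, hM, Matrix.det_smul, Matrix.det_transpose, hdet, mul_zero]

/-- If the associated form `A` defines a smooth hypersurface, then no power `ℓ^(T-1)` of a nonzero
linear form is zero in `M(φ)`: as `∂A/∂y_i = T ω(x_i ℓ_y^(T-1))`, the point `y` would be a
singular point. -/
theorem linForm_pow_notMem_J_of_isSmooth_associatedForm {n T : ℕ}
    {φ : Fin n → Poly n} (hs : IsSmoothHypersurface (associatedForm φ (T + 1))) {y : Fin n → ℂ}
    (hy : y ≠ 0) : linForm y ^ T ∉ J φ := by
  intro hmem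
  by_cases hex : ∃ A, IsAssociatedForm φ (T + 1) A
  · rw [associatedForm, dif_pos hex] at hs
    obtain ⟨ω, -, hω⟩ := hex.choose_spec
    obtain ⟨l, hl⟩ := LinearMap.exists_extend ω.toLinearMap
    set τ : Poly n →ₗ[ℂ] ℂ := l ∘ₗ (toM φ).toLinearMap with hτ
    have hA : hex.choose = dualForm τ (T + 1) := by
      refine MvPolynomial.funext fun z => ?_
      obtain ⟨h, hz⟩ := hω z
      rw [hz, eval_dualForm]
      have h1 := LinearMap.congr_fun hl ⟨(∑ i, z i • toM φ (X i)) ^ (T + 1), h⟩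
      rw [LinearMap.comp_apply, Submodule.subtype_apply] at h1
      refine h1.symm.trans ?_
      rw [hτ, LinearMap.comp_apply, AlgHom.toLinearMap_apply, map_pow (toM φ), toM_linForm]
    have hτ0 : ∀ p : Poly n, τ (p * linForm y ^ T) = 0 := fun p => by
      rw [hτ, LinearMap.comp_apply, AlgHom.toLinearMap_apply,
        toM_eq_zero_iff.2 (Ideal.mul_mem_left _ _ hmem), map_zero]
    rw [hA] at hs
    obtain ⟨i, hi⟩ := hs y hy (by rw [eval_dualForm, pow_succ', hτ0])
    rw [eval_pderiv_dualForm, hτ0, mul_zero] at hi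
    exact hi rfl
  · -- without an associated form the convention `A = 0` applies, and `A = 0` is not smooth
    rw [associatedForm, dif_neg hex] at hs
    obtain ⟨i, hi⟩ := hs y hy (map_zero _)
    rw [map_zero, map_zero] at hi
    exact hi rfl

theorem linForm_pow_notMem_J_of_inter_veronese_eq_empty {n m : ℕ} {I : Ideal (Poly n)}
    (h : projIdealPiece I m ∩ veroneseVariety n m = ∅) {y : Fin n → ℂ} (hy : y ≠ 0) :
    linForm y ^ m ∉ I := by
  intro hmem
  let ℓ : {ℓ : Forms n 1 // ℓ ≠ 0} :=
    ⟨⟨linForm y, linForm_isHomogeneous y⟩, fun h0 =>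
      linForm_ne_zero hy (congrArg Subtype.val h0)⟩
  have hmem' : veronesePoint m ℓ ∈ projIdealPiece I m ∩ veroneseVariety n m := by
    refine ⟨fun g hg => ?_, ⟨ℓ, rfl⟩⟩
    rw [veronesePoint, Projectivization.submodule_mk, Submodule.mem_span_singleton] at hg
    obtain ⟨a, rfl⟩ := hg
    exact (I.restrictScalars ℂ).smul_mem a hmem
  rw [h] at hmem'
  exact hmem'

/-! ### Openness in the form -/

/-- Smoothness of `f` together with surjectivity of `ℓ^(T-2)` on the Milnor algebra of `f`, for a
fixed `ℓ`, is a Zariski open condition on `f`. -/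
theorem exists_eval_ne_zero_imp_smooth_and_powMulSurjective {n d t : ℕ} (hd : 2 ≤ d)
    (ht : n * (d - 2) = t + 2) (hdt : d ≤ t + 2) {f₀ : Poly n} (hf₀ : f₀.IsHomogeneous d)
    (hs : IsSmoothHypersurface f₀) {ℓ : Poly n} (hℓ : ℓ.IsHomogeneous 1)
    (hsurj : PowMulSurjective (gradient f₀) t ℓ) :
    ∃ P : MvPolynomial (Fin n →₀ ℕ) ℂ, eval (fun α => coeff α f₀) P ≠ 0 ∧
      ∀ f ∈ Forms n d, eval (fun α => coeff α f) P ≠ 0 →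
        IsSmoothHypersurface f ∧ PowMulSurjective (gradient f) t ℓ := by
  have hgrad : ∀ {f : Poly n}, f.IsHomogeneous d → ∀ i, (gradient f i).IsHomogeneous (d - 1) :=
    fun hf i => hf.pderiv
  obtain ⟨N, hN⟩ := exists_X_pow_mem_J_gradient (by omega) hf₀ hs
  let V : (m : ℕ) → Fin n × {α : Fin n →₀ ℕ // α.degree = m} →
      MvPolynomial (Fin n) (MvPolynomial (Fin n →₀ ℕ) ℂ) := fun m k =>
    MvPolynomial.map C (monomial k.2.1 1) * pderiv k.1 (genericForm n d)
  have hV : ∀ m, ∀ f : Poly n, f.IsHomogeneous d → ∀ k,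
      specialize f (V m k) = monomial k.2.1 1 * gradient f k.1 := by
    intro m f hf k
    simp only [V]
    rw [map_mul, specialize_map_C, specialize_pderiv, specialize_genericForm hf, gradient]
  have hVhom : ∀ m, ∀ f : Poly n, f.IsHomogeneous d → ∀ k,
      (specialize f (V m k)).IsHomogeneous (m + (d - 1)) := by
    intro m f hf k
    rw [hV m f hf]
    exact (isHomogeneous_monomial 1 k.2.2).mul (hgrad hf k.1)
  have hVJ : ∀ m, ∀ f : Poly n, f.IsHomogeneous d → ∀ k,
      specialize f (V m k) ∈ J (gradient f) := by
    intro m f hf k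
    rw [hV m f hf]
    exact Ideal.mul_mem_left _ _ (Ideal.subset_span ⟨_, rfl⟩)
  have hspan : ∀ m, ∀ h : Poly n, h.IsHomogeneous (m + (d - 1)) → h ∈ J (gradient f₀) →
      h ∈ Submodule.span ℂ (Set.range fun k => specialize f₀ (V m k)) := by
    intro m h hh hJ
    simp only [hV m f₀ hf₀]
    exact mem_span_of_mem_J (hgrad hf₀) hh hJ
  -- all forms of degree `t + 3`, one more than the socle degree, lie in the Jacobian ideal
  obtain ⟨P, hP₀, hP⟩ := exists_eval_ne_zero_imp_forms_le_span (m := d) (N := t + 3)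
    (V (t + 4 - d)) (by
      intro f hf k
      have h := hVhom (t + 4 - d) f hf k
      rwa [show t + 4 - d + (d - 1) = t + 3 by omega] at h) f₀ (by
      intro h hh
      refine hspan _ h (by rwa [show t + 4 - d + (d - 1) = t + 3 by omega]) ?_
      by_contra hcon
      obtain ⟨j, hj, -⟩ := exists_mul_sub_C_mul_jac_mem (by omega) (hgrad hf₀) hN hh hcon
      have : d - 1 - 1 = d - 2 := by omega
      rw [this] at hj
      omega)
  let V' : (Fin n × {α : Fin n →₀ ℕ // α.degree = t + 2 - d}) ⊕ Fin n →
      MvPolynomial (Fin n) (MvPolynomial (Fin n →₀ ℕ) ℂ) :=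
    Sum.elim (V (t + 2 - d)) (fun j => MvPolynomial.map C (ℓ ^ t * X j))
  have hV'r : ∀ f j, specialize f (V' (Sum.inr j)) = ℓ ^ t * X j := fun f j =>
    specialize_map_C f _
  have hpow : (ℓ ^ t).IsHomogeneous t := by simpa using hℓ.pow t
  have hdeg : t + 2 - d + (d - 1) = t + 1 := by omega
  obtain ⟨P', hP'₀, hP'⟩ := exists_eval_ne_zero_imp_forms_le_span (m := d) (N := t + 1) V' (by
      rintro f hf (k | j)
      · have h := hVhom (t + 2 - d) f hf k
        rwa [hdeg] at h
      · rw [hV'r]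
        exact hpow.mul (isHomogeneous_X ℂ j)) f₀ (by
      intro g hg
      obtain ⟨s, hs, hmem⟩ := hsurj g hg
      obtain ⟨y, rfl⟩ := exists_eq_linForm hs
      have hl : g - ℓ ^ t * linForm y ∈
          Submodule.span ℂ (Set.range fun k => specialize f₀ (V' k)) := by
        refine Submodule.span_mono ?_ (hspan (t + 2 - d) _ ?_ hmem)
        · rintro _ ⟨k, rfl⟩
          exact ⟨Sum.inl k, rfl⟩
        · rw [hdeg]
          exact IsHomogeneous.sub hg (hpow.mul hs)
      have hr : ℓ ^ t * linForm y ∈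
          Submodule.span ℂ (Set.range fun k => specialize f₀ (V' k)) := by
        rw [linForm, Finset.mul_sum]
        refine Submodule.sum_mem _ fun j _ => ?_
        rw [mul_left_comm, ← smul_eq_C_mul]
        exact Submodule.smul_mem _ _ (Submodule.subset_span ⟨Sum.inr j, hV'r _ j⟩)
      simpa using Submodule.add_mem _ hl hr)
  refine ⟨P * P', by rw [map_mul]; exact mul_ne_zero hP₀ hP'₀, fun f hf hPP => ?_⟩
  rw [map_mul] at hPP
  have h1 := hP f hf (left_ne_zero_of_mul hPP)
  have h2 := hP' f hf (right_ne_zero_of_mul hPP)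
  constructor
  · refine isSmoothHypersurface_of_X_pow_mem (N := t + 3) fun j => ?_
    have hle : Submodule.span ℂ (Set.range fun k => specialize f (V (t + 4 - d) k)) ≤
        (J (gradient f)).restrictScalars ℂ := by
      rw [Submodule.span_le]
      rintro _ ⟨k, rfl⟩
      exact hVJ _ f hf k
    exact hle (h1 (isHomogeneous_X_pow j (t + 3)))
  · intro g hg
    have hle : Submodule.span ℂ (Set.range fun k => specialize f (V' k)) ≤
        (J (gradient f)).restrictScalars ℂ ⊔ (Forms n 1).map (LinearMap.mulLeft ℂ (ℓ ^ t)) := by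
      rw [Submodule.span_le]
      rintro _ ⟨k | j, rfl⟩
      · exact Submodule.mem_sup_left (hVJ _ f hf k)
      · exact Submodule.mem_sup_right ⟨X j, isHomogeneous_X ℂ j, (hV'r f j).symm⟩
    obtain ⟨a, ha, _, ⟨s, hs, rfl⟩, hab⟩ := Submodule.mem_sup.1 (hle (h2 hg))
    refine ⟨s, hs, ?_⟩
    rw [← hab, LinearMap.mulLeft_apply, add_sub_cancel_right]
    exact ha

/-! ### The Fermat form -/

/-- The operator `x_i ∂/∂x_i` multiplies the coefficient of `x^α` by `α_i`. -/
theorem coeff_X_mul_pderiv {n : ℕ} (p : Poly n) (i : Fin n) (α : Fin n →₀ ℕ) :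
    coeff α (X i * pderiv i p) = α i * coeff α p := by
  rw [coeff_X_mul']
  split_ifs with h
  · have hi : α i ≠ 0 := Finsupp.mem_support_iff.1 h
    have hle : Finsupp.single i 1 ≤ α := Finsupp.single_le_iff.2 (Nat.one_le_iff_ne_zero.2 hi)
    rw [coeff_pderiv, tsub_add_cancel_of_le hle, mul_comm, Finsupp.tsub_apply,
      Finsupp.single_eq_same, Nat.cast_sub (Nat.one_le_iff_ne_zero.2 hi), Nat.cast_one,
      sub_add_cancel]
  · rw [Finsupp.notMem_support_iff.1 h, Nat.cast_zero, zero_mul]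

theorem pderiv_linForm {n : ℕ} (y : Fin n → ℂ) (i : Fin n) : pderiv i (linForm y) = C (y i) := by
  rw [linForm, map_sum, Finset.sum_eq_single i]
  · rw [pderiv_C_mul, pderiv_X_self, mul_one]
  · intro j _ hj
    rw [pderiv_C_mul, pderiv_X_of_ne hj, mul_zero]
  · simp

theorem pderiv_linForm_one_pow {n : ℕ} (m : ℕ) (i : Fin n) :
    pderiv i (linForm (1 : Fin n → ℂ) ^ (m + 1)) =
      C ((m : ℂ) + 1) * linForm (1 : Fin n → ℂ) ^ m := by
  rw [pderiv_pow, pderiv_linForm, Pi.one_apply, C_1, mul_one, Nat.add_sub_cancel]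
  simp

theorem coeff_linForm_one_pow_ne_zero {n : ℕ} (m : ℕ) {α : Fin n →₀ ℕ} (hα : α.degree = m) :
    coeff α (linForm (1 : Fin n → ℂ) ^ m) ≠ 0 := by
  induction m generalizing α with
  | zero =>
    rw [Finsupp.degree_eq_zero_iff] at hα
    simp [hα]
  | succ m ih =>
    obtain ⟨i, hi⟩ : ∃ i, α i ≠ 0 := by
      by_contra hcon
      push Not at hcon
      have : α = 0 := Finsupp.ext hcon
      simp [this] at hα
    have hle : Finsupp.single i 1 ≤ α := Finsupp.single_le_iff.2 (Nat.one_le_iff_ne_zero.2 hi)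
    obtain ⟨β, rfl⟩ := exists_add_of_le hle
    have hβ : β.degree = m := by
      rw [map_add, Finsupp.degree_single] at hα
      omega
    have h := congrArg (coeff β) (pderiv_linForm_one_pow (n := n) m i)
    rw [coeff_pderiv, coeff_C_mul, add_comm β] at h
    intro h0
    rw [h0, zero_mul] at h
    exact mul_ne_zero (Nat.cast_add_one_ne_zero m) (ih hβ) h.symm

/-- The Fermat form `x_1^d + ⋯ + x_n^d`. -/
def fermat (n d : ℕ) : Poly n := ∑ i, X i ^ d

theorem fermat_isHomogeneous (n d : ℕ) : (fermat n d).IsHomogeneous d :=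
  IsHomogeneous.sum _ _ _ fun i _ => isHomogeneous_X_pow i d

theorem gradient_fermat (n d : ℕ) (i : Fin n) :
    gradient (fermat n d) i = C (d : ℂ) * X i ^ (d - 1) := by
  rw [gradient, fermat, map_sum, Finset.sum_eq_single i]
  · rw [pderiv_pow, pderiv_X_self, mul_one, map_natCast]
  · intro j _ hj
    rw [pderiv_pow, pderiv_X_of_ne hj, mul_zero]
  · simp

theorem X_pow_mem_J_fermat {n d : ℕ} (hd : d ≠ 0) (i : Fin n) :
    X i ^ (d - 1) ∈ J (gradient (fermat n d)) := by
  have h : C (d : ℂ)⁻¹ * gradient (fermat n d) i = X i ^ (d - 1) := by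
    rw [gradient_fermat, ← mul_assoc, ← map_mul, inv_mul_cancel₀ (Nat.cast_ne_zero.2 hd), map_one,
      one_mul]
  rw [← h]
  exact Ideal.mul_mem_left _ _ (Ideal.subset_span ⟨i, rfl⟩)

/-- The exponent `(m, …, m)`. -/
def constExponent (n m : ℕ) : Fin n →₀ ℕ := Finsupp.equivFunOnFinite.symm fun _ => m

theorem coeff_eq_zero_of_mem_J_fermat {n d : ℕ} (hd : 2 ≤ d) {p : Poly n}
    (hp : p ∈ J (gradient (fermat n d))) : coeff (constExponent n (d - 2)) p = 0 := by
  have hle : J (gradient (fermat n d)) ≤ Ideal.span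
      ((fun α => monomial α (1 : ℂ)) '' Set.range fun i => Finsupp.single i (d - 1)) := by
    rw [J, Ideal.span_le]
    rintro _ ⟨i, rfl⟩
    rw [gradient_fermat, X_pow_eq_monomial]
    exact Ideal.mul_mem_left _ _ (Ideal.subset_span ⟨_, ⟨i, rfl⟩, rfl⟩)
  by_contra hne
  obtain ⟨_, ⟨i, rfl⟩, h⟩ := mem_ideal_span_monomial_image.1 (hle hp) _ (mem_support_iff.2 hne)
  rw [Finsupp.single_le_iff] at h
  simp only [constExponent, Finsupp.equivFunOnFinite_symm_apply_apply] at h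
  omega

theorem coeff_jac_fermat_ne_zero {n d : ℕ} (hd : 2 ≤ d) :
    coeff (constExponent n (d - 2)) (jac (gradient (fermat n d))) ≠ 0 := by
  have hM : (Matrix.of fun i j => pderiv j (gradient (fermat n d) i)) =
      Matrix.diagonal fun i => C ((d : ℂ) * ((d - 1 : ℕ) : ℂ)) * X i ^ (d - 2) := by
    ext1 i j
    rw [Matrix.of_apply, gradient_fermat, pderiv_C_mul, pderiv_pow]
    by_cases hij : i = j
    · subst hij
      rw [pderiv_X_self, Matrix.diagonal_apply_eq, map_mul, map_natCast, map_natCast, mul_one,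
        mul_assoc, show d - 1 - 1 = d - 2 by omega]
    · rw [pderiv_X_of_ne hij, Matrix.diagonal_apply_ne _ hij, mul_zero, mul_zero]
  have hmon : ∏ i, (X i : Poly n) ^ (d - 2) = monomial (constExponent n (d - 2)) (1 : ℂ) := by
    rw [monomial_eq, C_1, one_mul, Finsupp.prod_fintype _ _ (by simp)]
    simp [constExponent]
  rw [jac, hM, Matrix.det_diagonal, Finset.prod_mul_distrib, hmon, ← map_prod, coeff_C_mul,
    coeff_monomial, if_pos rfl, mul_one, Finset.prod_const]
  exact pow_ne_zero _ (mul_ne_zero (Nat.cast_ne_zero.2 (by omega)) (Nat.cast_ne_zero.2 (by omega)))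

/-- On the Milnor algebra of the Fermat form the linear form `x_1 + ⋯ + x_n` is a Lefschetz element
in degree `1`. With `m = d - 2`, the pairing `(x_i, x_j) ↦ τ(x_i x_j ℓ^(T-2))`, where `τ` is the
coefficient of `(x_1 ⋯ x_n)^m`, has a matrix proportional to `m² - δ_ij m`: it can be read off from
the second partial derivatives of `ℓ^T`. This matrix is invertible as `n m ≠ 1`. -/
theorem powMulSurjective_fermat {n d t : ℕ} (hd : 3 ≤ d) (ht : n * (d - 2) = t + 2) :
    PowMulSurjective (gradient (fermat n d)) t (linForm 1) := by
  set ℓ : Poly n := linForm 1 with hℓ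
  set σ := constExponent n (d - 2) with hσ
  have hσi : ∀ i, (σ i : ℂ) = ((d - 2 : ℕ) : ℂ) := fun i => by simp [hσ, constExponent]
  have hm : ((d - 2 : ℕ) : ℂ) ≠ 0 := Nat.cast_ne_zero.2 (by omega)
  have hc : coeff σ (ℓ ^ (t + 2)) ≠ 0 := by
    refine coeff_linForm_one_pow_ne_zero (t + 2) ?_
    rw [Finsupp.degree_eq_sum]
    simp [hσ, constExponent, ht]
  have hdiff : ∀ i j : Fin n, pderiv i (pderiv j (ℓ ^ (t + 2))) =
      C (((t : ℂ) + 2) * ((t : ℂ) + 1)) * ℓ ^ t := by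
    intro i j
    rw [hℓ, pderiv_linForm_one_pow, pderiv_C_mul, pderiv_linForm_one_pow, ← mul_assoc, ← map_mul]
    push_cast
    congr 2
    ring
  have hentry : ∀ i j : Fin n, (((t : ℂ) + 2) * ((t : ℂ) + 1)) * coeff σ (X j * (X i * ℓ ^ t)) =
      ((d - 2 : ℕ) : ℂ) * (((d - 2 : ℕ) : ℂ) - if i = j then 1 else 0) *
        coeff σ (ℓ ^ (t + 2)) := by
    intro i j
    have h1 := coeff_X_mul_pderiv (X i * pderiv i (ℓ ^ (t + 2))) j σ
    rw [coeff_X_mul_pderiv (ℓ ^ (t + 2)) i, hσi, hσi, pderiv_mul, hdiff] at h1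
    have h2 : X j * (X i * (C (((t : ℂ) + 2) * ((t : ℂ) + 1)) * ℓ ^ t)) =
        C (((t : ℂ) + 2) * ((t : ℂ) + 1)) * (X j * (X i * ℓ ^ t)) := by ring
    rw [mul_add, coeff_add, h2, coeff_C_mul] at h1
    by_cases hij : i = j
    · subst hij
      rw [pderiv_X_self, one_mul, coeff_X_mul_pderiv, hσi] at h1
      rw [if_pos rfl]
      linear_combination h1
    · rw [pderiv_X_of_ne hij, zero_mul, mul_zero, coeff_zero] at h1
      rw [if_neg hij]
      linear_combination h1
  refine powMulSurjective_of_det_ne_zero (e := d - 1) (N := d - 2) (τ := lcoeff ℂ σ) (by omega)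
    (fun i => (fermat_isHomogeneous n d).pderiv) (fun j => ?_) ?_
    (fun p hp => coeff_eq_zero_of_mem_J_fermat (by omega) hp)
    (coeff_jac_fermat_ne_zero (by omega)) (linForm_isHomogeneous 1) ?_
  · rw [show d - 2 + 1 = d - 1 by omega]
    exact X_pow_mem_J_fermat (by omega) j
  · rw [show d - 1 - 1 = d - 2 by omega, ht]
  · intro hdet
    obtain ⟨s, hs, hker⟩ := Matrix.exists_mulVec_eq_zero_iff.2 hdet
    have hrow : ∀ i, ((d - 2 : ℕ) : ℂ) * ∑ j, s j = s i := by
      intro i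
      have h1 : ∑ j, coeff σ (X j * (X i * ℓ ^ t)) * s j = 0 := congrFun hker i
      have h2 : ∑ j, ((d - 2 : ℕ) : ℂ) * coeff σ (ℓ ^ (t + 2)) *
          (((d - 2 : ℕ) : ℂ) * s j - if i = j then s j else 0) = 0 := by
        refine Eq.trans ?_ ((congrArg (((t : ℂ) + 2) * ((t : ℂ) + 1) * ·) h1).trans (mul_zero _))
        rw [Finset.mul_sum]
        refine Finset.sum_congr rfl fun j _ => ?_
        rw [← mul_assoc, hentry]
        split_ifs <;> ring
      rw [← Finset.mul_sum, Finset.sum_sub_distrib, ← Finset.mul_sum, Finset.sum_ite_eq,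
        if_pos (Finset.mem_univ i)] at h2
      exact sub_eq_zero.1 ((mul_eq_zero.1 h2).resolve_left (mul_ne_zero hm hc))
    have hsum : ((n * (d - 2) : ℕ) : ℂ) * ∑ j, s j = ∑ j, s j := by
      conv_rhs => rw [← Finset.sum_congr rfl fun i _ => hrow i]
      rw [Finset.sum_const, Finset.card_univ, Fintype.card_fin, nsmul_eq_mul]
      push_cast
      ring
    rw [ht] at hsum
    have hsum0 : ∑ j, s j = 0 := by
      have h3 : ((t + 1 : ℕ) : ℂ) * ∑ j, s j = 0 := by
        push_cast at hsum ⊢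
        linear_combination hsum
      exact (mul_eq_zero.1 h3).resolve_left (Nat.cast_ne_zero.2 (Nat.succ_ne_zero t))
    exact hs (funext fun i => by rw [← hrow i, hsum0, mul_zero, Pi.zero_apply])

end CompleteIntersection

end

open CompleteIntersection in
theorem corollary1p6 (n d : ℕ) (hn : 3 ≤ n) (hd : 3 ≤ d) :
    (∀ f : MvPolynomial (Fin n) ℂ, f.IsHomogeneous d → IsSmoothHypersurface f →
      (IsSmoothHypersurface (associatedForm (gradient f) (n * (d - 2))) ∨
        projIdealPiece (J (gradient f)) (n * (d - 2) - 1) ∩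
          veroneseVariety n (n * (d - 2) - 1) = ∅) →
      SLPInDegree (gradient f) (n * (d - 2)) 1) ∧
    ForGenericForm n d fun f =>
      IsSmoothHypersurface f ∧ SLPInDegree (gradient f) (n * (d - 2)) 1 := by
  have hT : d ≤ n * (d - 2) := by
    have := Nat.mul_le_mul_right (d - 2) hn
    omega
  obtain ⟨t, ht⟩ : ∃ t, n * (d - 2) = t + 2 := ⟨n * (d - 2) - 2, by omega⟩
  have he : d - 1 ≠ 0 := by omega
  have ht' : n * (d - 1 - 1) = t + 2 := by rw [show d - 1 - 1 = d - 2 by omega, ht]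
  have hgrad : ∀ {f : MvPolynomial (Fin n) ℂ}, f.IsHomogeneous d →
      ∀ i, (gradient f i).IsHomogeneous (d - 1) := fun hf i => hf.pderiv
  rw [ht, show t + 2 - 1 = t + 1 by omega]
  constructor
  · intro f hf hs h
    obtain ⟨N, hN⟩ := exists_X_pow_mem_J_gradient (by omega) hf hs
    have hℓ : ∀ y : Fin n → ℂ, y ≠ 0 → linForm y ^ (t + 1) ∉ J (gradient f) := fun y hy =>
      h.elim (fun h1 => linForm_pow_notMem_J_of_isSmooth_associatedForm h1 hy)
        (fun h2 => linForm_pow_notMem_J_of_inter_veronese_eq_empty h2 hy)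
    obtain ⟨y, hy⟩ := exists_powMulSurjective he (hgrad hf) hN ht' hℓ
    exact slpInDegree_one_of_powMulSurjective he (hgrad hf) hN ht' (linForm_isHomogeneous y) hy
  · have hsF : IsSmoothHypersurface (fermat n d) :=
      isSmoothHypersurface_of_X_pow_mem (X_pow_mem_J_fermat (by omega))
    obtain ⟨P, hP₀, hP⟩ := exists_eval_ne_zero_imp_smooth_and_powMulSurjective (by omega) ht
      (by omega) (fermat_isHomogeneous n d) hsF (linForm_isHomogeneous 1)
      (powMulSurjective_fermat hd ht)
    refine ⟨P, ⟨fermat n d, fermat_isHomogeneous n d, hP₀⟩, fun f hf hPf => ?_⟩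
    obtain ⟨hs, hsurj⟩ := hP f hf hPf
    obtain ⟨N, hN⟩ := exists_X_pow_mem_J_gradient (by omega) hf hs
    exact ⟨hs, slpInDegree_one_of_powMulSurjective he (hgrad hf) hN ht'
      (linForm_isHomogeneous 1) hsurj⟩
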